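/- Let $(\Omega,P)$ be a probability space on which $\mathbb R^3$ acts by a group $(\tau_x)_{x\in\mathbb R^3}$ of measurable, $P$-preserving bijections, $\tau_x\tau_y=\tau_{x+y}$. Assume that the action is ergodic (a measurable set that agrees up to a null set with each of its translates has probability $0$ or $1$) and that the unitary group $(T_xf)(\omega)=f(\tau_{-x}\omega)$ on $\mathscr H_0=L^2(\Omega,P;\mathbb C)$ is strongly continuous. Let $L_i$ ($i=1,2,3$) be the infinitesimal generator of $t\mapsto T_{te_i}$, let $\langle\cdot\rangle$ denote the expectation, and put $\mathscr H=\mathscr H_0^3$ with inner product $\langle\xi,\zeta\rangle=\sum_i\langle\xi_i,\zeta_i\rangle_0$. Let $$\mathscr H^1_0=\{f\in\textstyle\bigcap_i\mathcal D(L_i):\langle f\rangle=0\},\qquad \mathscr H^2_0=\{f\in\mathscr H_0^1: f\in\mathcal D(L_iL_j)\text{ for all }i,j\},$$ $\mathscr H^k=(\mathscr H^k_0)^3$, and let $\overline{\mathscr H^2}$ be the completion (closure) of $\mathscr H^2$ in the norm of $\mathscr H$. Define $\nabla\varphi=(L_1\varphi,L_2\varphi,L_3\varphi)$ on $\mathcal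 D(\nabla)=\mathscr H_0^2$; $\nabla^*\zeta=-\sum_iL_i\zeta_i$ for $\zeta\in\mathscr H^1$; and $\nabla\times\xi=(L_2\xi_3-L_3\xi_2,\;L_3\xi_1-L_1\xi_3,\;L_1\xi_2-L_2\xi_1)$ for $\xi\in\mathscr H^1$. Let $\overline{\mathcal R(\nabla)}$ and $\overline{\mathcal R(\nabla\times)}$ be the closures in $\mathscr H$ of $\nabla(\mathscr H^2_0)$ and $\nabla\times(\mathscr H^2)$. Then: 1. $\nabla^*\nabla$ (on $\mathscr H^2_0$) and $\nabla\times\nabla\times$ (on $\{A\in\mathscr H^2:\nabla^*A=0\}$) have trivial kernel. Let $\Gamma$ be the closure of $\nabla(\nabla^*\nabla)^{-1}\nabla^*$, and $\Upsilon$ the closure of $\nabla\times(\nabla\times\nabla\times)^{-1}\nabla\times$; here these compositions have their natural domains in $\mathscr H^1$, and the leftmost $\nabla$ and $\nabla\times$ act on $\mathscr H^2_0$ and $\mathscr H^2$. Then $\Gamma$ and $\Upsilon$ have domain exactly $\overline{\mathscr H^2}$, on which they are the orthogonal projections onto $\overline{\mathcal R(\nabla)}$ and $\overline{\mathcal R(\nabla\times)}$.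 2. On $\overline{\mathscr H^2}$ one has $\Gamma\Upsilon=\Upsilon\Gamma=0$ and $\Gamma+\Upsilon=I$. Consequently $\overline{\mathscr H^2}=\overline{\mathcal R(\nabla)}\oplus\overline{\mathcal R(\nabla\times)}$, an orthogonal direct sum. 3. $\overline{\mathcal R(\nabla\times)}=\mathcal K(\nabla^*)$ and $\overline{\mathcal R(\nabla)}=\mathcal K(\nabla\times)$, where $\mathcal K(\nabla^*)$ is the set of $\zeta\in\mathscr H$ with $\langle\zeta\rangle=0$ and $\sum_iL_i\zeta_i=0$ weakly, and $\mathcal K(\nabla\times)$ is the set of $\xi\in\mathscr H$ with $\langle\xi\rangle=0$ and $L_i\xi_j-L_j\xi_i=0$ weakly for all $i,j$. ("Weakly" means tested against all $\varphi\in\bigcap_i\mathcal D(L_i)$, with each $L_i$ moved to $\varphi$ by skew-adjointness.) 4. The same holds on $\mathscr H^2$ before completion: $\Gamma$ and $\Upsilon$ map $\mathscr H^2$ into itself, $\mathscr H^2=(\mathscr H^2\cap\overline{\mathcal R(\nabla)})\oplus(\mathscr H^2\cap\overline{\mathcal R(\nabla\times)})$, $\mathscr H^2\cap\overline{\mathcal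 R(\nabla\times)}=\{\zeta\in\mathscr H^2:\nabla^*\zeta=0\}$ and $\mathscr H^2\cap\overline{\mathcal R(\nabla)}=\{\xi\in\mathscr H^2:\nabla\times\xi=0\}$. -/

import Mathlib

open MeasureTheory

noncomputable section

/-- Composition of partially defined operators with its natural domain
`{x ∈ D(f) | f x ∈ D(g)}`. -/
def LinearPMap.pcomp {R E F G : Type*} [Ring R] [AddCommGroup E] [Module R E]
    [AddCommGroup F] [Module R F] [AddCommGroup G] [Module R G]
    (g : F →ₗ.[R] G) (f : E →ₗ.[R] F) : E →ₗ.[R] G where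
  domain := (g.domain.comap f.toFun).map f.domain.subtype
  toFun := g.toFun ∘ₗ LinearMap.codRestrict g.domain
    (f.toFun ∘ₗ Submodule.inclusion (Submodule.map_subtype_le f.domain _))
    (by rintro ⟨x, ⟨y, hy, rfl⟩⟩; exact hy)

/-- The kernel of a partially defined operator, as a subspace of the ambient space. -/
def LinearPMap.kernel {R E F : Type*} [Ring R] [AddCommGroup E] [Module R E]
    [AddCommGroup F] [Module R F] (f : E →ₗ.[R] F) : Submodule R E :=
  (LinearMap.ker f.toFun).map f.domain.subtype

/-- The range of a partially defined operator. -/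
def LinearPMap.rangeSpace {R E F : Type*} [Ring R] [AddCommGroup E] [Module R E]
    [AddCommGroup F] [Module R F] (f : E →ₗ.[R] F) : Submodule R F :=
  LinearMap.range f.toFun

namespace StationaryHelmholtz

/-- Physical space `ℝ³`. -/
abbrev Space : Type := EuclideanSpace ℝ (Fin 3)

section

variable {Ω : Type*} [MeasurableSpace Ω]

/-- Scalar fields: `𝓗₀ = L²(Ω, P)`, complex valued. -/
abbrev Scalar (P : Measure Ω) : Type _ := Lp ℂ 2 P

/-- Vector fields: `𝓗 = 𝓗₀³`, with inner product `∑ i, ⟪ξ i, ζ i⟫`. -/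
abbrev Vec (P : Measure Ω) : Type _ := PiLp 2 (fun _ : Fin 3 => Scalar P)

/-- `𝓗₀`-functions of ensemble average zero. -/
def meanZero (P : Measure Ω) [IsProbabilityMeasure P] : Submodule ℂ (Scalar P) where
  carrier := {f | ∫ ω, f ω ∂P = 0}
  zero_mem' := by
    change ∫ ω, (0 : Scalar P) ω ∂P = 0
    rw [integral_congr_ae (Lp.coeFn_zero ℂ 2 P)]
    simp
  add_mem' := by
    intro f g hf hg
    change ∫ ω, (f + g : Scalar P) ω ∂P = 0
    rw [integral_congr_ae (Lp.coeFn_add f g)]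
    have h1 : Integrable f P := (Lp.memLp f).integrable (by norm_num)
    have h2 : Integrable g P := (Lp.memLp g).integrable (by norm_num)
    have h3 := integral_add h1 h2
    simp only [Set.mem_ofPred_eq] at hf hg
    simpa [hf, hg] using h3
  smul_mem' := by
    intro c f hf
    change ∫ ω, (c • f : Scalar P) ω ∂P = 0
    rw [integral_congr_ae (Lp.coeFn_smul c f)]
    simp only [Set.mem_ofPred_eq] at hf
    simp only [Pi.smul_apply]
    rw [integral_smul, hf, smul_zero]

/-- Vector fields all of whose components lie in `S`. -/
def vecOf {P : Measure Ω} (S : Submodule ℂ (Scalar P)) : Submodule ℂ (Vec P) where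
  carrier := {ξ | ∀ i, ξ i ∈ S}
  zero_mem' := fun _ => S.zero_mem
  add_mem' := fun ha hb i => S.add_mem (ha i) (hb i)
  smul_mem' := fun c _ hx i => S.smul_mem c (hx i)

/-- The `i`-th component of fields in `vecOf S`. -/
def component {P : Measure Ω} (S : Submodule ℂ (Scalar P)) (i : Fin 3) : vecOf S →ₗ[ℂ] S where
  toFun ξ := ⟨ξ.1 i, ξ.2 i⟩
  map_add' _ _ := rfl
  map_smul' _ _ := rfl

/-- Assemble a vector-valued linear map from its components. -/
def assemble {P : Measure Ω} {M : Type*} [AddCommGroup M] [Module ℂ M]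
    (f : Fin 3 → M →ₗ[ℂ] Scalar P) : M →ₗ[ℂ] Vec P :=
  (WithLp.linearEquiv 2 ℂ (Fin 3 → Scalar P)).symm.toLinearMap ∘ₗ LinearMap.pi f

end

section

variable {Ω : Type*} [MeasurableSpace Ω] [AddAction Space Ω] [MeasurableConstVAdd Space Ω]
  (P : Measure Ω) [VAddInvariantMeasure Space Ω P]

/-- The unitary group `(T_x f)(ω) = f (τ_{-x} ω)` on `𝓗₀`, where `τ_x ω = x +ᵥ ω`. -/
def translate (x : Space) : Scalar P →ₗᵢ[ℂ] Scalar P :=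
  Lp.compMeasurePreservingₗᵢ ℂ (fun ω : Ω => (-x) +ᵥ ω) (measurePreserving_vadd (-x) P)

/-- The orbit of `f` under translations along the `i`-th coordinate direction. -/
def orbit (i : Fin 3) (f : Scalar P) : ℝ → Scalar P :=
  fun t => translate P (t • EuclideanSpace.single i (1 : ℝ)) f

/-- The infinitesimal generator `L_i` of the `i`-th one-parameter group:
`L_i f = ∂/∂x_i (T_x f)` at `x = 0`, the derivative being taken in the norm of `𝓗₀`, with domain
all `f` for which this derivative exists. -/
def generator (i : Fin 3) : Scalar P →ₗ.[ℂ] Scalar P where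
  domain :=
    { carrier := {f | DifferentiableAt ℝ (orbit P i f) 0}
      zero_mem' := by
        have h : orbit P i 0 = fun _ => 0 := by funext t; simp [orbit]
        simp [h]
      add_mem' := by
        intro f g hf hg
        have h : orbit P i (f + g) = orbit P i f + orbit P i g := by
          funext t; simp [orbit]
        simp only [Set.mem_ofPred_eq] at hf hg ⊢
        rw [h]
        exact hf.add hg
      smul_mem' := by
        intro c f hf
        have h : orbit P i (c • f) = c • orbit P i f := by funext t; simp [orbit]
        simp only [Set.mem_ofPred_eq] at hf ⊢
        rw [h]
        exact hf.const_smul c }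
  toFun :=
    { toFun := fun f => deriv (orbit P i f) 0
      map_add' := by
        rintro ⟨f, hf⟩ ⟨g, hg⟩
        have h : orbit P i (f + g) = orbit P i f + orbit P i g := by
          funext t; simp [orbit]
        change deriv (orbit P i (f + g)) 0 = _
        rw [h]
        exact deriv_add hf hg
      map_smul' := by
        rintro c ⟨f, hf⟩
        have h : orbit P i (c • f) = c • orbit P i f := by funext t; simp [orbit]
        change deriv (orbit P i (c • f)) 0 = _
        rw [h]
        exact deriv_const_smul c hf }

/-- `𝓓 = ⋂ i, D(L_i)`. -/
def commonDomain : Submodule ℂ (Scalar P) := ⨅ i, (generator P i).domain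

variable [IsProbabilityMeasure P]

/-- `𝓗¹₀`: mean-zero fields in the domain of every `L_i`. -/
def H10 : Submodule ℂ (Scalar P) := commonDomain P ⊓ meanZero P

/-- `𝓗²₀`: mean-zero fields in the domain of every `L_i` and every product `L_i L_j`. -/
def H20 : Submodule ℂ (Scalar P) :=
  commonDomain P ⊓ (⨅ i, ⨅ j, ((generator P i).pcomp (generator P j)).domain) ⊓ meanZero P

/-- `𝓗¹ = (𝓗¹₀)³`. -/
def H1 : Submodule ℂ (Vec P) := vecOf (H10 P)

/-- `𝓗² = (𝓗²₀)³`. -/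
def H2 : Submodule ℂ (Vec P) := vecOf (H20 P)

/-- The completion of `𝓗²` for the norm of `𝓗`. -/
def H2bar : Submodule ℂ (Vec P) := (H2 P).topologicalClosure

/-- `L_i` on `𝓗¹₀`. -/
def partialH10 (i : Fin 3) : H10 P →ₗ[ℂ] Scalar P :=
  (generator P i).toFun ∘ₗ Submodule.inclusion
    (inf_le_left.trans (iInf_le (fun i => (generator P i).domain) i))

/-- `ξ ↦ L_i ξ_j` on `𝓗¹`. -/
def partialH1 (i j : Fin 3) : H1 P →ₗ[ℂ] Scalar P :=
  partialH10 P i ∘ₗ component (H10 P) j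

/-- The divergence-type operator `∇* ζ = -∑ i, L_i ζ_i`, with domain `𝓗¹`. -/
def gradStar : Vec P →ₗ.[ℂ] Scalar P where
  domain := H1 P
  toFun := -∑ i, partialH1 P i i

/-- The curl with domain `𝓗¹`. -/
def curlH1 : Vec P →ₗ.[ℂ] Vec P where
  domain := H1 P
  toFun := assemble ![partialH1 P 1 2 - partialH1 P 2 1,
    partialH1 P 2 0 - partialH1 P 0 2,
    partialH1 P 0 1 - partialH1 P 1 0]

/-- The gradient `∇ φ = (L_1 φ, L_2 φ, L_3 φ)` with domain `𝓗²₀`. -/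
def grad : Scalar P →ₗ.[ℂ] Vec P :=
  (LinearPMap.mk (H10 P) (assemble (partialH10 P))).domRestrict (H20 P)

/-- The curl with domain `𝓗²`. -/
def curl : Vec P →ₗ.[ℂ] Vec P := (curlH1 P).domRestrict (H2 P)

/-- `∇* ∇`. -/
def gradStarGrad : Scalar P →ₗ.[ℂ] Scalar P := (gradStar P).pcomp (grad P)

/-- `∇× ∇×`, with domain the part of `𝓗²` on which `∇*` vanishes. -/
def curlCurl : Vec P →ₗ.[ℂ] Vec P :=
  ((curlH1 P).pcomp (curl P)).domRestrict (H2 P ⊓ (gradStar P).kernel)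

/-- The closure of `∇ (∇* ∇)⁻¹ ∇*`, the latter having its natural domain inside `𝓗¹`. -/
def Gam : Vec P →ₗ.[ℂ] Vec P :=
  ((grad P).pcomp ((gradStarGrad P).inverse.pcomp (gradStar P))).closure

/-- The closure of `∇× (∇× ∇×)⁻¹ ∇×`, the latter having its natural domain inside `𝓗¹`. -/
def Ups : Vec P →ₗ.[ℂ] Vec P :=
  ((curl P).pcomp ((curlCurl P).inverse.pcomp (curlH1 P))).closure

/-- The closure in `𝓗` of the range of the gradient. -/
def gradRange : Submodule ℂ (Vec P) := (grad P).rangeSpace.topologicalClosure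

/-- The closure in `𝓗` of the range of the curl. -/
def curlRange : Submodule ℂ (Vec P) := (curl P).rangeSpace.topologicalClosure

instance : (gradRange P).HasOrthogonalProjection :=
  haveI : CompleteSpace (gradRange P) :=
    (Submodule.isClosed_topologicalClosure _).completeSpace_coe
  inferInstance

instance : (curlRange P).HasOrthogonalProjection :=
  haveI : CompleteSpace (curlRange P) :=
    (Submodule.isClosed_topologicalClosure _).completeSpace_coe
  inferInstance

/-- Membership in the weak kernel of `∇*`: mean-zero `ζ ∈ 𝓗` with `∑ i, L_i ζ_i = 0` weakly. -/
def IsWeaklyDivFree (ζ : Vec P) : Prop :=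
  ζ ∈ vecOf (meanZero P) ∧
    ∀ (φ : Scalar P) (hφ : ∀ i, φ ∈ (generator P i).domain),
      ∑ i, inner ℂ (generator P i ⟨φ, hφ i⟩) (ζ i) = 0

/-- Membership in the weak kernel of `∇×`: mean-zero `ξ ∈ 𝓗` with
`L_i ξ_j - L_j ξ_i = 0` weakly for all `i, j`. -/
def IsWeaklyCurlFree (ξ : Vec P) : Prop :=
  ξ ∈ vecOf (meanZero P) ∧
    ∀ (φ : Scalar P) (hφ : ∀ i, φ ∈ (generator P i).domain) (i j : Fin 3),
      inner ℂ (generator P i ⟨φ, hφ i⟩) (ξ j) - inner ℂ (generator P j ⟨φ, hφ j⟩) (ξ i) = 0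

end

end StationaryHelmholtz

end

/-! The whole argument is Hilbert space geometry together with smoothing; no Poisson equation is
solved. Translations are unitary, so each generator is skew-adjoint, and tested against a dense
domain the generators commute. Hence `∇*` is formally adjoint to `∇`, the curl is symmetric, and
gradients are orthogonal to curls.

The core is completeness: a mean-zero field `ζ` orthogonal to every gradient and every curl is zero
(`eq_zero_of_inner_eq_zero`). Averaging `T_x` over short segments in the three directions gives
contractions `A n` that commute with translations, tend strongly to the identity and gain one
derivative. Smoothing twice puts `ζ` in `H2`; moving the smoothing to the test fields by its adjoint
keeps both orthogonality relations, so the smoothed field has zero divergence and zero curl. Each of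
its components then has zero Laplacian, so zero gradient, so is translation invariant, and
ergodicity with mean zero makes it vanish (`eq_zero_of_div_curl_eq_zero`).

Thus the two projections sum to the identity on mean-zero fields, which form the closure of `H2`.
Whenever the formula for `Gam` or `Ups` sends `x` to `y`, the difference `x - y` is divergence free,
respectively curl free, so `y` is the projection of `x`. It remains to see that the domain of each
formula is dense, since a densely defined restriction of a bounded operator closes up to that
operator (`LinearPMap.closure_eq_toPMap`). Both domains contain all gradients and curls. For `Ups`
this needs a divergence-free potential, obtained by projection: projections onto
translation-invariant subspaces commute with the generators and so preserve `H2`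
(`starProjection_mem_H2`), which also gives the decomposition before completion. -/

open Filter Topology

namespace StationaryHelmholtz

/-! ### Translations, partial derivatives and skew-adjointness -/

section

variable {Ω : Type*} [MeasurableSpace Ω] [AddAction Space Ω] [MeasurableConstVAdd Space Ω]
  {P : Measure Ω} [VAddInvariantMeasure Space Ω P]

/-- Translations are strongly continuous on `𝓗₀`. -/
abbrev StronglyContinuous (P : Measure Ω) [VAddInvariantMeasure Space Ω P] : Prop :=
  ∀ f : Scalar P, Continuous fun x => translate P x f

theorem translate_coeFn (x : Space) (f : Scalar P) :
    translate P x f =ᵐ[P] fun ω => f ((-x) +ᵥ ω) :=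
  Lp.coeFn_compMeasurePreserving f (measurePreserving_vadd (-x) P)

theorem translate_zero (f : Scalar P) : translate P 0 f = f := by
  apply Lp.ext
  filter_upwards [translate_coeFn (P := P) 0 f] with ω hω
  simp [hω]

theorem translate_add (x y : Space) (f : Scalar P) :
    translate P (x + y) f = translate P x (translate P y f) := by
  apply Lp.ext
  have h := (measurePreserving_vadd (-x) P).quasiMeasurePreserving.ae_eq_comp
    (translate_coeFn (P := P) y f)
  filter_upwards [translate_coeFn (P := P) (x + y) f,
    translate_coeFn (P := P) x (translate P y f), h] with ω h1 h2 h3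
  rw [h1, h2]
  simp only [Function.comp_apply] at h3
  rw [h3, vadd_vadd, neg_add_rev]

theorem translate_comm (x y : Space) (f : Scalar P) :
    translate P x (translate P y f) = translate P y (translate P x f) := by
  rw [← translate_add, add_comm, translate_add]

theorem translate_translate_neg (x : Space) (f : Scalar P) :
    translate P x (translate P (-x) f) = f := by
  rw [← translate_add, add_neg_cancel, translate_zero]

theorem inner_translate_left (x : Space) (f g : Scalar P) :
    inner ℂ (translate P x f) g = inner ℂ f (translate P (-x) g) := by
  rw [← (translate P x).inner_map_map f, translate_translate_neg]

theorem integral_translate (x : Space) (f : Scalar P) :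
    ∫ ω, translate P x f ω ∂P = ∫ ω, f ω ∂P := by
  rw [integral_congr_ae (translate_coeFn x f)]
  exact (measurePreserving_vadd (-x) P).integral_comp
    (MeasurableEquiv.vadd (-x)).measurableEmbedding f

theorem orbit_zero (i : Fin 3) (f : Scalar P) : orbit P i f 0 = f := by
  simp [orbit, translate_zero]

theorem orbit_add (i : Fin 3) (f : Scalar P) (s t : ℝ) :
    orbit P i f (s + t) = translate P (s • EuclideanSpace.single i (1 : ℝ)) (orbit P i f t) := by
  simp only [orbit, add_smul, translate_add]

/-- `g` is the `i`-th partial derivative of `f`: that is, `f ∈ D(L_i)` and `L_i f = g`. -/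
def HasPartial (i : Fin 3) (f g : Scalar P) : Prop := HasDerivAt (orbit P i f) g 0

theorem mem_generator_domain_iff {i : Fin 3} {f : Scalar P} :
    f ∈ (generator P i).domain ↔ ∃ g, HasPartial i f g :=
  ⟨fun h => ⟨_, DifferentiableAt.hasDerivAt h⟩, fun ⟨_, h⟩ => h.differentiableAt⟩

theorem HasPartial.mem {i : Fin 3} {f g : Scalar P} (h : HasPartial i f g) :
    f ∈ (generator P i).domain := mem_generator_domain_iff.2 ⟨g, h⟩

theorem hasPartial_generator {i : Fin 3} (f : (generator P i).domain) :
    HasPartial i f (generator P i f) := DifferentiableAt.hasDerivAt f.2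

theorem HasPartial.unique {i : Fin 3} {f g g' : Scalar P} (h : HasPartial i f g)
    (h' : HasPartial i f g') : g = g' := HasDerivAt.unique h h'

theorem HasPartial.generator_eq {i : Fin 3} {f g : Scalar P} (h : HasPartial i f g)
    (hf : f ∈ (generator P i).domain) : generator P i ⟨f, hf⟩ = g :=
  (hasPartial_generator ⟨f, hf⟩).unique h

theorem HasPartial.add {i : Fin 3} {f g f' g' : Scalar P} (h : HasPartial i f f')
    (h' : HasPartial i g g') : HasPartial i (f + g) (f' + g') := by
  have e : orbit P i (f + g) = orbit P i f + orbit P i g := by funext t; simp [orbit]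
  rw [HasPartial, e]; exact HasDerivAt.add h h'

theorem HasPartial.sub {i : Fin 3} {f g f' g' : Scalar P} (h : HasPartial i f f')
    (h' : HasPartial i g g') : HasPartial i (f - g) (f' - g') := by
  have e : orbit P i (f - g) = orbit P i f - orbit P i g := by funext t; simp [orbit]
  rw [HasPartial, e]; exact HasDerivAt.sub h h'

/-- By the group law, the orbit near `t` is a fixed isometry applied to the orbit near `0`. -/
theorem HasPartial.hasDerivAt_orbit {i : Fin 3} {f g : Scalar P} (h : HasPartial i f g) (t : ℝ) :
    HasDerivAt (orbit P i f) (orbit P i g t) t := by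
  have e : orbit P i f = fun s =>
      translate P (t • EuclideanSpace.single i (1 : ℝ)) (orbit P i f (s - t)) := by
    funext s; rw [← orbit_add]; congr 1; ring
  have h1 : HasDerivAt (fun s => orbit P i f (s - t)) g t := by
    apply HasDerivAt.comp_sub_const
    rw [sub_self]
    exact h
  rw [e]
  exact ((translate P (t • EuclideanSpace.single i (1 : ℝ))).toContinuousLinearMap.restrictScalars
    ℝ).hasFDerivAt.comp_hasDerivAt t h1

theorem HasPartial.translate {i : Fin 3} {f g : Scalar P} (h : HasPartial i f g) (x : Space) :
    HasPartial i (translate P x f) (translate P x g) := by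
  have e : orbit P i (StationaryHelmholtz.translate P x f) = fun s =>
      StationaryHelmholtz.translate P x (orbit P i f s) := by
    funext s; exact translate_comm _ _ _
  rw [HasPartial, e]
  exact ((StationaryHelmholtz.translate P x).toContinuousLinearMap.restrictScalars
    ℝ).hasFDerivAt.comp_hasDerivAt 0 h

/-- The generators are skew-adjoint. -/
theorem HasPartial.inner_eq_neg {i : Fin 3} {f g f' g' : Scalar P} (h : HasPartial i f f')
    (h' : HasPartial i g g') : inner ℂ f' g = - inner ℂ f g' := by
  have h1 := HasDerivAt.inner ℂ h h'
  -- Translating both arguments preserves the inner product, so its derivative at `0` vanishes; the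
  -- product rule gives the claim.
  have e : (fun t => inner ℂ (orbit P i f t) (orbit P i g t)) = fun _ => inner ℂ f g := by
    funext t; exact (StationaryHelmholtz.translate P _).inner_map_map f g
  rw [e] at h1
  have := h1.unique (hasDerivAt_const _ _)
  rw [orbit_zero, orbit_zero] at this
  rw [eq_neg_iff_add_eq_zero, add_comm, this]

theorem HasPartial.translate_eq {i : Fin 3} {f : Scalar P} (h : HasPartial i f 0) (t : ℝ) :
    StationaryHelmholtz.translate P (t • EuclideanSpace.single i (1 : ℝ)) f = f := by
  have h1 : ∀ t, HasDerivAt (orbit P i f) 0 t := fun t => by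
    simpa [orbit] using h.hasDerivAt_orbit t
  have := is_const_of_deriv_eq_zero (fun t => (h1 t).differentiableAt) (fun t => (h1 t).deriv) t 0
  rwa [orbit_zero] at this

theorem translate_eq_of_hasPartial_zero {f : Scalar P} (h : ∀ i, HasPartial i f 0) (x : Space) :
    translate P x f = f := by
  have e : x = x 0 • EuclideanSpace.single 0 (1 : ℝ) + (x 1 • EuclideanSpace.single 1 (1 : ℝ) +
      x 2 • EuclideanSpace.single 2 (1 : ℝ)) := by
    ext i; fin_cases i <;> simp
  rw [e, translate_add, translate_add, (h 2).translate_eq, (h 1).translate_eq, (h 0).translate_eq]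

end

/-! ### Mean-zero functions and ergodicity -/

section

variable {Ω : Type*} [MeasurableSpace Ω] {P : Measure Ω}

theorem isClosed_vecOf {S : Submodule ℂ (Scalar P)} (hS : IsClosed (S : Set (Scalar P))) :
    IsClosed (vecOf S : Set (Vec P)) := by
  have : (vecOf S : Set (Vec P)) = ⋂ i, (fun ξ : Vec P => ξ i) ⁻¹' S := by
    ext ξ; simp only [Set.mem_iInter]; rfl
  rw [this]
  exact isClosed_iInter fun i => hS.preimage (PiLp.continuous_apply 2 _ i)

variable [IsProbabilityMeasure P]

theorem mem_meanZero {f : Scalar P} : f ∈ meanZero P ↔ ∫ ω, f ω ∂P = 0 := Iff.rfl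

/-- The constant function `1` in `𝓗₀`. -/
noncomputable def oneScalar (P : Measure Ω) [IsProbabilityMeasure P] : Scalar P :=
  indicatorConstLp 2 MeasurableSet.univ (measure_ne_top P _) 1

theorem inner_oneScalar (f : Scalar P) : inner ℂ (oneScalar P) f = ∫ ω, f ω ∂P := by
  rw [oneScalar, L2.inner_indicatorConstLp_one, setIntegral_univ]

theorem isClosed_meanZero : IsClosed (meanZero P : Set (Scalar P)) := by
  have : (meanZero P : Set (Scalar P)) = {f | inner ℂ (oneScalar P) f = 0} := by
    ext f
    simp only [inner_oneScalar]
    rfl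
  rw [this]
  exact isClosed_eq (by fun_prop) continuous_const

variable [AddAction Space Ω] [MeasurableConstVAdd Space Ω]

/-- Preimages of measurable sets under an invariant `f` are invariant up to null sets, hence null or
conull. So `f` is almost everywhere constant, and the constant is its mean. -/
theorem eq_zero_of_translate_eq [ErgodicVAdd Space Ω P] {f : Scalar P}
    (h : ∀ x, translate P x f = f) (hf : f ∈ meanZero P) : f = 0 := by
  have hm : NullMeasurable f P := (Lp.aestronglyMeasurable f).aemeasurable.nullMeasurable
  obtain ⟨c, hc⟩ : ∃ c, f =ᵐ[P] Function.const Ω c := by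
    refine exists_eventuallyEq_const_of_forall_separating MeasurableSet fun U hU => ?_
    have h1 : EventuallyConst ((f : Ω → ℂ) ⁻¹' U) (ae P) := by
      refine aeconst_of_forall_preimage_vadd_ae_eq Space (hm hU) fun x => ?_
      have h2 := translate_coeFn (P := P) (-x) f
      rw [h (-x), neg_neg] at h2
      refine (h2.mono fun ω hω => ?_).set_eq
      simp only [Set.mem_preimage]
      rw [hω]
    rcases Filter.eventuallyConst_set.1 h1 with h2 | h2
    · exact Or.inl h2
    · exact Or.inr h2
  have h0 : c = 0 := by
    have := mem_meanZero.1 hf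
    rw [integral_congr_ae hc] at this
    simpa using this
  apply Lp.ext
  filter_upwards [hc, Lp.coeFn_zero ℂ 2 P] with ω h1 h2
  rw [h1, h2, h0]; rfl

variable [VAddInvariantMeasure Space Ω P]

theorem translate_mem_meanZero {f : Scalar P} (hf : f ∈ meanZero P) (x : Space) :
    translate P x f ∈ meanZero P := by
  rw [mem_meanZero, integral_translate]; exact hf

/-- The expectation is constant along an orbit, so its derivative is zero, whatever the mean of `f`.
-/
theorem HasPartial.mem_meanZero {i : Fin 3} {f g : Scalar P} (h : HasPartial i f g) :
    g ∈ meanZero P := by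
  rw [StationaryHelmholtz.mem_meanZero, ← inner_oneScalar]
  have h1 := HasDerivAt.inner ℂ (hasDerivAt_const (0 : ℝ) (oneScalar P)) h
  have e : (fun t => inner ℂ (oneScalar P) (orbit P i f t)) = fun _ => ∫ ω, f ω ∂P := by
    funext t; rw [inner_oneScalar, orbit, integral_translate]
  rw [e] at h1
  simpa using h1.unique (hasDerivAt_const _ _)

end

end StationaryHelmholtz

namespace StationaryHelmholtz

/-! ### Smoothing by averages and commutation of the generators -/

section

variable {Ω : Type*} [MeasurableSpace Ω] [AddAction Space Ω] [MeasurableConstVAdd Space Ω]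
  {P : Measure Ω} [VAddInvariantMeasure Space Ω P]

/-- The bounded operator `B` commutes with all translations. -/
def CommutesTranslate (B : Scalar P →L[ℂ] Scalar P) : Prop :=
  ∀ x f, B (translate P x f) = translate P x (B f)

theorem CommutesTranslate.hasPartial {B : Scalar P →L[ℂ] Scalar P} (hB : CommutesTranslate B)
    {i : Fin 3} {f g : Scalar P} (h : HasPartial i f g) : HasPartial i (B f) (B g) := by
  have e : orbit P i (B f) = fun s => B (orbit P i f s) := by
    funext s; exact (hB _ _).symm
  rw [HasPartial, e]
  exact (B.restrictScalars ℝ).hasFDerivAt.comp_hasDerivAt 0 h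

theorem CommutesTranslate.comp {A B : Scalar P →L[ℂ] Scalar P} (hA : CommutesTranslate A)
    (hB : CommutesTranslate B) : CommutesTranslate (A ∘L B) := fun x f => by
  simp [hB x f, hA x (B f)]

theorem CommutesTranslate.adjoint {B : Scalar P →L[ℂ] Scalar P} (hB : CommutesTranslate B) :
    CommutesTranslate B.adjoint := fun x f => by
  refine ext_inner_right ℂ fun g => ?_
  rw [ContinuousLinearMap.adjoint_inner_left, inner_translate_left, inner_translate_left, ← hB,
    ContinuousLinearMap.adjoint_inner_left]

theorem continuous_orbit (hT : StronglyContinuous P) (i : Fin 3) (f : Scalar P) :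
    Continuous (orbit P i f) :=
  (hT f).comp (by fun_prop)

/-- The average `h⁻¹ ∫₀ʰ T_{t e_i} f dt`. -/
noncomputable def average (hT : StronglyContinuous P) (i : Fin 3) (h : ℝ) :
    Scalar P →L[ℂ] Scalar P :=
  LinearMap.mkContinuous
    { toFun := fun f => h⁻¹ • ∫ t in (0 : ℝ)..h, orbit P i f t
      map_add' := fun f g => by
        rw [← smul_add, ← intervalIntegral.integral_add
          ((continuous_orbit hT i f).intervalIntegrable _ _)
          ((continuous_orbit hT i g).intervalIntegrable _ _)]
        simp [orbit]
      map_smul' := fun c f => by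
        rw [RingHom.id_apply, smul_comm, ← intervalIntegral.integral_smul]
        simp [orbit] }
    -- This bound is `1` for `h ≠ 0` and `0` for `h = 0`, so the definition needs no case
    -- distinction.
    (|h⁻¹| * |h|) fun f => by
      change ‖h⁻¹ • ∫ t in (0 : ℝ)..h, orbit P i f t‖ ≤ _
      rw [norm_smul, Real.norm_eq_abs, mul_assoc]
      refine mul_le_mul_of_nonneg_left ?_ (abs_nonneg _)
      have := intervalIntegral.norm_integral_le_of_norm_le_const (a := 0) (b := h)
        (f := orbit P i f) (C := ‖f‖) fun t _ => ((translate P _).norm_map f).le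
      rwa [sub_zero, mul_comm] at this

theorem average_apply (hT : StronglyContinuous P) (i : Fin 3) (h : ℝ) (f : Scalar P) :
    average hT i h f = h⁻¹ • ∫ t in (0 : ℝ)..h, orbit P i f t := rfl

theorem norm_average_apply_le (hT : StronglyContinuous P) (i : Fin 3) (h : ℝ) (f : Scalar P) :
    ‖average hT i h f‖ ≤ ‖f‖ := by
  refine (ContinuousLinearMap.le_of_opNorm_le _ (LinearMap.mkContinuous_norm_le _
    (by positivity) _) f).trans ?_
  rw [← abs_mul]
  by_cases h0 : h = 0 <;> simp [h0]

theorem average_commutes (hT : StronglyContinuous P) (i : Fin 3) (h : ℝ) :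
    CommutesTranslate (average hT i h) := fun x f => by
  rw [average_apply, average_apply]
  have e : orbit P i (translate P x f) = fun t =>
      (translate P x).toContinuousLinearMap (orbit P i f t) := by
    funext t; exact translate_comm _ _ _
  rw [e, ContinuousLinearMap.intervalIntegral_comp_comm _
    ((continuous_orbit hT i f).intervalIntegrable _ _)]
  exact ((translate P x).toContinuousLinearMap.map_smul_of_tower h⁻¹ _).symm

/-- Translating the average by `s` shifts the interval of integration to `[s, s + h]`; the
fundamental theorem of calculus at both endpoints gives the derivative. -/
theorem hasPartial_average (hT : StronglyContinuous P) (i : Fin 3) (h : ℝ) (f : Scalar P) :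
    HasPartial i (average hT i h f) (h⁻¹ • (orbit P i f h - f)) := by
  have hc := continuous_orbit hT i f
  have hd : ∀ s, HasDerivAt (fun u => ∫ t in (0 : ℝ)..u, orbit P i f t) (orbit P i f s) s :=
    fun s => intervalIntegral.integral_hasDerivAt_right (hc.intervalIntegrable _ _)
      (hc.stronglyMeasurableAtFilter _ _) hc.continuousAt
  have e : orbit P i (average hT i h f) = fun s =>
      h⁻¹ • ((∫ t in (0 : ℝ)..(s + h), orbit P i f t) - ∫ t in (0 : ℝ)..s, orbit P i f t) := by
    funext s
    rw [orbit, ← average_commutes, average_apply, intervalIntegral.integral_interval_sub_left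
      (hc.intervalIntegrable _ _) (hc.intervalIntegrable _ _)]
    congr 1
    have e1 : ∀ t, orbit P i (translate P (s • EuclideanSpace.single i (1 : ℝ)) f) t =
        orbit P i f (t + s) := fun t => by rw [orbit_add]; rfl
    simp only [e1]
    rw [intervalIntegral.integral_comp_add_right, zero_add, add_comm]
  rw [HasPartial, e]
  have h1 := hd (0 + h)
  have h2 : HasDerivAt (fun s => ∫ t in (0 : ℝ)..(s + h), orbit P i f t) (orbit P i f h) 0 := by
    have := h1.comp_add_const 0 h
    rwa [zero_add] at this
  have h3 := hd 0
  rw [orbit_zero] at h3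
  exact (h2.sub h3).const_smul h⁻¹

theorem tendsto_average (hT : StronglyContinuous P) (i : Fin 3) (f : Scalar P) :
    Tendsto (fun n : ℕ => average hT i (1 / ((n : ℝ) + 1)) f) atTop (𝓝 f) := by
  have hc := continuous_orbit hT i f
  have hd : HasDerivAt (fun u => ∫ t in (0 : ℝ)..u, orbit P i f t) (orbit P i f 0) 0 :=
    intervalIntegral.integral_hasDerivAt_right (hc.intervalIntegrable _ _)
      (hc.stronglyMeasurableAtFilter _ _) hc.continuousAt
  have h1 := hd.tendsto_slope_zero
  rw [orbit_zero] at h1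
  have h2 : Tendsto (fun n : ℕ => 1 / ((n : ℝ) + 1)) atTop (𝓝[≠] 0) := by
    refine tendsto_nhdsWithin_iff.2 ⟨tendsto_one_div_add_atTop_nhds_zero_nat, ?_⟩
    exact Eventually.of_forall fun n => by
      simp only [Set.mem_compl_iff, Set.mem_singleton_iff]; positivity
  have h3 := h1.comp h2
  simpa [Function.comp_def, average_apply] using h3

/-- Contractions commuting with the translations and converging strongly to the identity. -/
structure IsApproxIdentity (A : ℕ → Scalar P →L[ℂ] Scalar P) : Prop where
  commutes : ∀ n, CommutesTranslate (A n)
  norm_le : ∀ n f, ‖A n f‖ ≤ ‖f‖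
  tendsto : ∀ f, Tendsto (fun n => A n f) atTop (𝓝 f)

theorem IsApproxIdentity.comp {A B : ℕ → Scalar P →L[ℂ] Scalar P} (hA : IsApproxIdentity A)
    (hB : IsApproxIdentity B) : IsApproxIdentity fun n => A n ∘L B n where
  commutes n := (hA.commutes n).comp (hB.commutes n)
  norm_le n f := (hA.norm_le n _).trans (hB.norm_le n f)
  tendsto f := by
    have h1 : Tendsto (fun n => A n (B n f - f)) atTop (𝓝 0) :=
      squeeze_zero_norm (fun n => hA.norm_le n _)
        (by simpa using (tendsto_iff_norm_sub_tendsto_zero.1 (hB.tendsto f)))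
    simpa using h1.add (hA.tendsto f)

theorem isApproxIdentity_average (hT : StronglyContinuous P) (i : Fin 3) :
    IsApproxIdentity fun n : ℕ => average hT i (1 / ((n : ℝ) + 1)) where
  commutes _ := average_commutes hT i _
  norm_le _ f := norm_average_apply_le hT i _ f
  tendsto f := tendsto_average hT i f

/-- The product of the averages in the three directions works: each factor gains a derivative in its
own direction, and the factors to its left commute with translations and so keep it. -/
theorem exists_isApproxIdentity_hasPartial (hT : StronglyContinuous P) :
    ∃ A : ℕ → Scalar P →L[ℂ] Scalar P, IsApproxIdentity A ∧
      ∀ n f i, ∃ g, HasPartial i (A n f) g := by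
  refine ⟨_, (isApproxIdentity_average hT 0).comp ((isApproxIdentity_average hT 1).comp
    (isApproxIdentity_average hT 2)), fun n f i => ?_⟩
  simp only [ContinuousLinearMap.comp_apply]
  fin_cases i
  · exact ⟨_, hasPartial_average hT 0 _ _⟩
  · exact ⟨_, (average_commutes hT 0 _).hasPartial (hasPartial_average hT 1 _ _)⟩
  · exact ⟨_, (average_commutes hT 0 _).hasPartial ((average_commutes hT 1 _).hasPartial
      (hasPartial_average hT 2 _ _))⟩

/-- The common domain is dense, because the smoothings `A n g` lie in it and tend to `g`. -/
theorem eq_of_forall_hasPartial_inner_eq (hT : StronglyContinuous P) {u v : Scalar P}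
    (h : ∀ g, (∀ i, ∃ g', HasPartial i g g') → inner ℂ u g = inner ℂ v g) : u = v := by
  obtain ⟨A, hA, hA'⟩ := exists_isApproxIdentity_hasPartial hT
  refine ext_inner_right ℂ fun g => ?_
  have h1 := (tendsto_const_nhds (x := u)).inner (𝕜 := ℂ) (hA.tendsto g)
  have h2 := (tendsto_const_nhds (x := v)).inner (𝕜 := ℂ) (hA.tendsto g)
  refine tendsto_nhds_unique h1 (h2.congr fun n => ?_)
  exact (h _ (hA' n g)).symm

/-- The generators commute: `L_i L_j f = L_j L_i f`. -/
theorem HasPartial.comm (hT : StronglyContinuous P) {i j : Fin 3} {f fi fj fij fji : Scalar P}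
    (hi : HasPartial i f fi) (hj : HasPartial j f fj) (hij : HasPartial i fj fij)
    (hji : HasPartial j fi fji) : fij = fji := by
  refine eq_of_forall_hasPartial_inner_eq hT fun g hg => ?_
  obtain ⟨g', hg'⟩ := hg j
  rw [hji.inner_eq_neg hg']
  -- Skew-adjointness in direction `j` gives `⟪T_t L_j f, g⟫ = -⟪T_t f, L_j g⟫` for all `t`.
  -- Differentiating in direction `i` at `0` needs only first derivatives of `g`.
  have h1 := HasDerivAt.inner ℂ hij (hasDerivAt_const (0 : ℝ) g)
  have h2 := (HasDerivAt.inner ℂ hi (hasDerivAt_const (0 : ℝ) g')).neg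
  have e : (fun t => inner ℂ (orbit P i fj t) g) = fun t => -inner ℂ (orbit P i f t) g' := by
    funext t
    exact (hj.translate _).inner_eq_neg hg'
  rw [e] at h1
  simpa using h1.unique h2

end

/-! ### Invariant functions, and operators commuting with translations -/

section

variable {Ω : Type*} [MeasurableSpace Ω] [AddAction Space Ω] [MeasurableConstVAdd Space Ω]
  {P : Measure Ω} [IsProbabilityMeasure P] [ErgodicVAdd Space Ω P]

theorem translate_oneScalar (x : Space) : translate P x (oneScalar P) = oneScalar P := by
  refine ext_inner_right ℂ fun f => ?_
  rw [inner_translate_left, inner_oneScalar, inner_oneScalar, integral_translate]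

theorem eq_smul_oneScalar_of_translate_eq {f : Scalar P} (h : ∀ x, translate P x f = f) :
    f = inner ℂ (oneScalar P) f • oneScalar P := by
  rw [← sub_eq_zero]
  refine eq_zero_of_translate_eq (fun x => ?_) ?_
  · simp [h, translate_oneScalar]
  · have h1 : inner ℂ (oneScalar P) (oneScalar P) = 1 := by
      rw [inner_oneScalar, oneScalar, integral_indicatorConstLp]
      simp
    rw [mem_meanZero, ← inner_oneScalar, inner_sub_right, inner_smul_right, h1]
    ring

/-- The mean of `B f` is `⟪1, B f⟫ = ⟪B* 1, f⟫`, and `B* 1` is translation invariant, hence constant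
by ergodicity. -/
theorem CommutesTranslate.mem_meanZero {B : Scalar P →L[ℂ] Scalar P} (hB : CommutesTranslate B)
    {f : Scalar P} (hf : f ∈ meanZero P) : B f ∈ meanZero P := by
  have h1 : ∀ x, translate P x (B.adjoint (oneScalar P)) = B.adjoint (oneScalar P) := fun x => by
    rw [← hB.adjoint, translate_oneScalar]
  rw [StationaryHelmholtz.mem_meanZero, ← inner_oneScalar, ← ContinuousLinearMap.adjoint_inner_left,
    eq_smul_oneScalar_of_translate_eq h1, inner_smul_left, inner_oneScalar f,
    StationaryHelmholtz.mem_meanZero.1 hf, mul_zero]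

end

end StationaryHelmholtz

/-! ### Graphs of partially defined operators -/

section

variable {R E F G : Type*} [Ring R] [AddCommGroup E] [Module R E] [AddCommGroup F] [Module R F]
  [AddCommGroup G] [Module R G]

/-- Partial operators are handled through their graphs, so that composition and inversion become
statements about relations, free of subtypes. -/
theorem LinearPMap.mem_graph_pcomp {g : F →ₗ.[R] G} {f : E →ₗ.[R] F} {x : E} {z : G} :
    (x, z) ∈ (g.pcomp f).graph ↔ ∃ y, (x, y) ∈ f.graph ∧ (y, z) ∈ g.graph := by
  simp only [LinearPMap.mem_graph_iff]
  constructor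
  · rintro ⟨⟨x, ⟨y, hy, rfl⟩⟩, rfl, rfl⟩
    exact ⟨f y, ⟨y, rfl, rfl⟩, ⟨f y, hy⟩, rfl, rfl⟩
  · rintro ⟨_, ⟨y, rfl, rfl⟩, ⟨w, hw, rfl⟩⟩
    have hy : f y ∈ g.domain := hw ▸ w.2
    refine ⟨⟨y, ⟨y, hy, rfl⟩⟩, rfl, ?_⟩
    have : w = ⟨f y, hy⟩ := Subtype.ext hw
    rw [this]
    rfl

theorem LinearPMap.mem_kernel {f : E →ₗ.[R] F} {x : E} : x ∈ f.kernel ↔ (x, (0 : F)) ∈ f.graph := by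
  simp only [LinearPMap.mem_graph_iff]
  constructor
  · rintro ⟨y, hy, rfl⟩
    exact ⟨y, rfl, hy⟩
  · rintro ⟨y, rfl, hy⟩
    exact ⟨y, hy, rfl⟩

theorem LinearPMap.mem_rangeSpace {f : E →ₗ.[R] F} {y : F} :
    y ∈ f.rangeSpace ↔ ∃ x, (x, y) ∈ f.graph := by
  simp only [LinearPMap.mem_graph_iff]
  constructor
  · rintro ⟨x, rfl⟩
    exact ⟨x, x, rfl, rfl⟩
  · rintro ⟨_, x, rfl, rfl⟩
    exact ⟨x, rfl⟩

theorem LinearPMap.mem_graph_inverse {f : E →ₗ.[R] F} (hf : f.kernel = ⊥) {x : E} {y : F} :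
    (y, x) ∈ f.inverse.graph ↔ (x, y) ∈ f.graph := by
  have hk : LinearMap.ker f.toFun = ⊥ := by
    refine (Submodule.eq_bot_iff _).2 fun x hx => Subtype.ext ?_
    have h : (x : E) ∈ f.kernel := ⟨x, hx, rfl⟩
    rw [hf] at h
    exact h
  rw [LinearPMap.inverse_graph hk]
  constructor
  · rintro ⟨⟨a, b⟩, h, e⟩
    cases e
    exact h
  · exact fun h => ⟨(x, y), h, rfl⟩

theorem LinearPMap.mem_graph_domRestrict {f : E →ₗ.[R] F} {S : Submodule R E} {x : E} {y : F} :
    (x, y) ∈ (f.domRestrict S).graph ↔ x ∈ S ∧ (x, y) ∈ f.graph := by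
  simp only [LinearPMap.mem_graph_iff]
  constructor
  · rintro ⟨⟨x, hx⟩, rfl, rfl⟩
    exact ⟨hx.1, ⟨x, hx.2⟩, rfl, rfl⟩
  · rintro ⟨hx, ⟨x, rfl, rfl⟩⟩
    exact ⟨⟨x, hx, x.2⟩, rfl, rfl⟩

theorem LinearPMap.mem_graph_toPMap {f : E →ₗ[R] F} {S : Submodule R E} {x : E} {y : F} :
    (x, y) ∈ (f.toPMap S).graph ↔ x ∈ S ∧ y = f x := by
  simp only [LinearPMap.mem_graph_iff]
  constructor
  · rintro ⟨x, rfl, rfl⟩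
    exact ⟨x.2, rfl⟩
  · rintro ⟨hx, rfl⟩
    exact ⟨⟨x, hx⟩, rfl, rfl⟩

end

/-- The closure of a restriction of a bounded operator is its restriction to the closure of the
domain. -/
theorem LinearPMap.closure_eq_toPMap {𝕜 E F : Type*} [NontriviallyNormedField 𝕜]
    [NormedAddCommGroup E] [NormedSpace 𝕜 E] [NormedAddCommGroup F] [NormedSpace 𝕜 F]
    {f : E →ₗ.[𝕜] F} {p : E →L[𝕜] F} (h : ∀ x y, (x, y) ∈ f.graph → y = p x)
    {K : Submodule 𝕜 E} (hK : f.domain.topologicalClosure = K) :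
    f.closure = p.toLinearMap.toPMap K := by
  subst hK
  set q := p.toLinearMap.toPMap f.domain.topologicalClosure
  have hqc : q.IsClosed := by
    have : (q.graph : Set (E × F)) =
        Prod.fst ⁻¹' (f.domain.topologicalClosure : Set E) ∩ {z | z.2 = p z.1} := by
      ext ⟨x, y⟩
      exact LinearPMap.mem_graph_toPMap
    rw [LinearPMap.IsClosed, this]
    exact (f.domain.isClosed_topologicalClosure.preimage continuous_fst).inter
      (isClosed_eq (by fun_prop) (by fun_prop))
  have hle : f ≤ q := LinearPMap.le_of_le_graph fun ⟨x, y⟩ hxy =>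
    LinearPMap.mem_graph_toPMap.2
      ⟨f.domain.le_topologicalClosure (LinearPMap.mem_domain_of_mem_graph hxy), h x y hxy⟩
  have hf : f.IsClosable := hqc.isClosable.leIsClosable hle
  refine LinearPMap.eq_of_eq_graph (le_antisymm ?_ ?_)
  · rw [← hf.graph_closure_eq_closure_graph]
    exact Submodule.topologicalClosure_minimal _ (LinearPMap.le_graph_of_le hle) hqc
  · rw [← hf.graph_closure_eq_closure_graph]
    rintro ⟨x, y⟩ hxy
    obtain ⟨hx, rfl⟩ := LinearPMap.mem_graph_toPMap.1 hxy
    -- This map carries the domain of `f` into its graph, hence the closure of the domain into the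
    -- closed graph.
    have hc : Continuous fun x => (x, p x) := by fun_prop
    refine map_mem_closure (f := fun x => (x, p x)) (t := (f.graph : Set (E × F))) hc
      (show x ∈ _root_.closure (f.domain : Set E) from hx) fun z hz => ?_
    have := f.mem_graph ⟨z, hz⟩
    rwa [h _ _ this] at this

/-- Invariance of `K` under the adjoint `D` makes `Kᗮ` invariant under `C`, so `C` respects the
splitting into `K` and `Kᗮ`. -/
theorem Submodule.starProjection_comm_of_mapsTo {𝕜 E : Type*} [RCLike 𝕜] [NormedAddCommGroup E]
    [InnerProductSpace 𝕜 E] {K : Submodule 𝕜 E} [K.HasOrthogonalProjection] {C D : E →L[𝕜] E}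
    (hCD : ∀ x y, inner 𝕜 (C x) y = inner 𝕜 x (D y)) (hC : ∀ x ∈ K, C x ∈ K)
    (hD : ∀ x ∈ K, D x ∈ K) (x : E) : K.starProjection (C x) = C (K.starProjection x) := by
  refine Submodule.eq_starProjection_of_mem_of_inner_eq_zero
    (hC _ (Submodule.starProjection_apply_mem _ _)) fun w hw => ?_
  rw [← map_sub, hCD]
  exact Submodule.starProjection_inner_eq_zero _ _ (hD w hw)

theorem ContinuousLinearMap.map_mem_topologicalClosure {𝕜 E : Type*} [NontriviallyNormedField 𝕜]
    [NormedAddCommGroup E] [NormedSpace 𝕜 E] {B : E →L[𝕜] E} {S : Submodule 𝕜 E}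
    (h : ∀ ξ ∈ S, B ξ ∈ S) {ξ : E} (hξ : ξ ∈ S.topologicalClosure) :
    B ξ ∈ S.topologicalClosure :=
  map_mem_closure B.continuous hξ h

namespace StationaryHelmholtz

/-! ### Componentwise operators and the curl -/

section

variable {Ω : Type*} [MeasurableSpace Ω] {P : Measure Ω}

theorem mem_vecOf {S : Submodule ℂ (Scalar P)} {ξ : Vec P} : ξ ∈ vecOf S ↔ ∀ i, ξ i ∈ S := Iff.rfl

/-- A bounded operator on scalar fields, applied to every component of a vector field. -/
noncomputable def mapVec (B : Scalar P →L[ℂ] Scalar P) : Vec P →L[ℂ] Vec P :=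
  (PiLp.continuousLinearEquiv 2 ℂ (fun _ : Fin 3 => Scalar P)).symm.toContinuousLinearMap ∘L
    ContinuousLinearMap.pi fun i => B ∘L PiLp.proj 2 (fun _ : Fin 3 => Scalar P) i

theorem inner_mapVec_left {B C : Scalar P →L[ℂ] Scalar P}
    (h : ∀ f g, inner ℂ (B f) g = inner ℂ f (C g)) (ξ ζ : Vec P) :
    inner ℂ (mapVec B ξ) ζ = inner ℂ ξ (mapVec C ζ) := by
  rw [PiLp.inner_apply, PiLp.inner_apply]
  exact Finset.sum_congr rfl fun i _ => h _ _

theorem tendsto_vec {α : Type*} {l : Filter α} {u : α → Vec P} {ξ : Vec P}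
    (h : ∀ i, Tendsto (fun a => u a i) l (𝓝 (ξ i))) : Tendsto u l (𝓝 ξ) := by
  have h1 := ((PiLp.continuousLinearEquiv 2 ℂ
    (fun _ : Fin 3 => Scalar P)).symm.continuous.tendsto _).comp (tendsto_pi_nhds.2 h)
  exact h1

/-- The curl of a field with partial derivatives `D i j = L_i ξ_j`. -/
noncomputable def curlOf (D : Fin 3 → Fin 3 → Scalar P) : Vec P :=
  WithLp.toLp 2 ![D 1 2 - D 2 1, D 2 0 - D 0 2, D 0 1 - D 1 0]

theorem curlOf_zero (D : Fin 3 → Fin 3 → Scalar P) : curlOf D 0 = D 1 2 - D 2 1 := rfl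

theorem curlOf_one (D : Fin 3 → Fin 3 → Scalar P) : curlOf D 1 = D 2 0 - D 0 2 := rfl

theorem curlOf_two (D : Fin 3 → Fin 3 → Scalar P) : curlOf D 2 = D 0 1 - D 1 0 := rfl

theorem inner_vec (ξ ζ : Vec P) : inner ℂ ξ ζ =
    inner ℂ (ξ 0) (ζ 0) + inner ℂ (ξ 1) (ζ 1) + inner ℂ (ξ 2) (ζ 2) := by
  rw [PiLp.inner_apply, Fin.sum_univ_three]

theorem mapVec_curlOf (B : Scalar P →L[ℂ] Scalar P) (D : Fin 3 → Fin 3 → Scalar P) :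
    mapVec B (curlOf D) = curlOf fun i j => B (D i j) := by
  ext1 i
  fin_cases i <;> exact map_sub B _ _

theorem curlOf_eq_zero_iff {D : Fin 3 → Fin 3 → Scalar P} :
    curlOf D = 0 ↔ ∀ i j, D i j = D j i := by
  constructor
  · intro h
    have h0 : D 1 2 - D 2 1 = 0 := congrArg (fun ξ : Vec P => ξ 0) h
    have h1 : D 2 0 - D 0 2 = 0 := congrArg (fun ξ : Vec P => ξ 1) h
    have h2 : D 0 1 - D 1 0 = 0 := congrArg (fun ξ : Vec P => ξ 2) h
    rw [sub_eq_zero] at h0 h1 h2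
    intro i j
    fin_cases i <;> fin_cases j <;> simp [h0, h1, h2]
  · intro h
    ext1 i
    fin_cases i
    · exact sub_eq_zero.2 (h 1 2)
    · exact sub_eq_zero.2 (h 2 0)
    · exact sub_eq_zero.2 (h 0 1)

end

/-! ### Domains and differential operators in terms of partial derivatives -/

section

variable {Ω : Type*} [MeasurableSpace Ω] [AddAction Space Ω] [MeasurableConstVAdd Space Ω]
  {P : Measure Ω} [VAddInvariantMeasure Space Ω P]

theorem mem_commonDomain {f : Scalar P} :
    f ∈ commonDomain P ↔ ∃ g : Fin 3 → Scalar P, ∀ i, HasPartial i f (g i) := by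
  simp only [commonDomain, Submodule.mem_iInf, mem_generator_domain_iff]
  exact ⟨fun h => ⟨_, fun i => (h i).choose_spec⟩, fun ⟨g, hg⟩ i => ⟨_, hg i⟩⟩

theorem mem_graph_generator {i : Fin 3} {f g : Scalar P} :
    (f, g) ∈ (generator P i).graph ↔ HasPartial i f g := by
  rw [LinearPMap.mem_graph_iff]
  constructor
  · rintro ⟨f, rfl, rfl⟩
    exact hasPartial_generator f
  · exact fun h => ⟨⟨f, h.mem⟩, rfl, h.generator_eq h.mem⟩

variable [IsProbabilityMeasure P]

theorem mem_H10 {f : Scalar P} :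
    f ∈ H10 P ↔ f ∈ meanZero P ∧ ∃ g : Fin 3 → Scalar P, ∀ i, HasPartial i f (g i) := by
  rw [H10, Submodule.mem_inf, mem_commonDomain, and_comm]

theorem mem_H20 {f : Scalar P} :
    f ∈ H20 P ↔ f ∈ meanZero P ∧ ∃ (g : Fin 3 → Scalar P) (h : Fin 3 → Fin 3 → Scalar P),
      (∀ i, HasPartial i f (g i)) ∧ ∀ i j, HasPartial i (g j) (h i j) := by
  rw [H20, Submodule.mem_inf, Submodule.mem_inf, mem_commonDomain, and_comm]
  refine and_congr_right fun _ => ?_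
  simp only [Submodule.mem_iInf, LinearPMap.mem_domain_iff, LinearPMap.mem_graph_pcomp,
    mem_graph_generator]
  constructor
  · rintro ⟨⟨g, hg⟩, h⟩
    choose h u hu hh using h
    refine ⟨g, h, hg, fun i j => ?_⟩
    rw [(hg j).unique (hu i j)]
    exact hh i j
  · rintro ⟨g, h, hg, hh⟩
    exact ⟨⟨g, hg⟩, fun i j => ⟨_, _, hg j, hh i j⟩⟩

theorem H20_le_H10 : H20 P ≤ H10 P := fun _ hf =>
  let ⟨h0, g, _, hg, _⟩ := mem_H20.1 hf
  mem_H10.2 ⟨h0, g, hg⟩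

theorem mem_H1 {ξ : Vec P} : ξ ∈ H1 P ↔ ξ ∈ vecOf (meanZero P) ∧
    ∃ D : Fin 3 → Fin 3 → Scalar P, ∀ i j, HasPartial i (ξ j) (D i j) := by
  simp only [H1, mem_vecOf, mem_H10]
  constructor
  · intro h
    choose h0 D hD using h
    exact ⟨h0, fun i j => D j i, fun i j => hD j i⟩
  · rintro ⟨h0, D, hD⟩ j
    exact ⟨h0 j, fun i => D i j, fun i => hD i j⟩

theorem mem_H2 {ξ : Vec P} : ξ ∈ H2 P ↔ ξ ∈ vecOf (meanZero P) ∧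
    ∃ (D : Fin 3 → Fin 3 → Scalar P) (E : Fin 3 → Fin 3 → Fin 3 → Scalar P),
      (∀ i j, HasPartial i (ξ j) (D i j)) ∧ ∀ i j k, HasPartial i (D j k) (E i j k) := by
  simp only [H2, mem_vecOf, mem_H20]
  constructor
  · intro h
    choose h0 D E hD hE using h
    exact ⟨h0, fun i j => D j i, fun i j k => E k i j, fun i j => hD j i, fun i j k => hE k i j⟩
  · rintro ⟨h0, D, E, hD, hE⟩ j
    exact ⟨h0 j, fun i => D i j, fun i k => E i k j, fun i => hD i j, fun i k => hE i k j⟩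

theorem H2_le_H1 : H2 P ≤ H1 P := fun _ h i => H20_le_H10 (h i)

theorem hasPartial_partialH1 (i j : Fin 3) (ξ : H1 P) :
    HasPartial i (ξ.1 j) (partialH1 P i j ξ) :=
  hasPartial_generator ⟨ξ.1 j, (mem_H10.1 (ξ.2 j)).2.choose_spec i |>.mem⟩

theorem mem_graph_gradStar {ζ : Vec P} {d : Scalar P} : (ζ, d) ∈ (gradStar P).graph ↔
    ζ ∈ vecOf (meanZero P) ∧ ∃ D : Fin 3 → Fin 3 → Scalar P,
      (∀ i j, HasPartial i (ζ j) (D i j)) ∧ d = -∑ i, D i i := by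
  rw [LinearPMap.mem_graph_iff]
  have key : ∀ ζ : H1 P, (gradStar P) ζ = -∑ i, partialH1 P i i ζ := fun ζ => by
    change (-∑ i, partialH1 P i i) ζ = _
    simp
  constructor
  · rintro ⟨ζ, rfl, rfl⟩
    exact ⟨(mem_H1.1 ζ.2).1, fun i j => partialH1 P i j ζ, fun i j => hasPartial_partialH1 i j ζ,
      key ζ⟩
  · rintro ⟨h0, D, hD, rfl⟩
    refine ⟨⟨ζ, mem_H1.2 ⟨h0, D, hD⟩⟩, rfl, (key _).trans ?_⟩
    congr 1
    exact Finset.sum_congr rfl fun i _ => (hasPartial_partialH1 i i _).unique (hD i i)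

theorem mem_graph_curlH1 {ξ η : Vec P} : (ξ, η) ∈ (curlH1 P).graph ↔
    ξ ∈ vecOf (meanZero P) ∧ ∃ D : Fin 3 → Fin 3 → Scalar P,
      (∀ i j, HasPartial i (ξ j) (D i j)) ∧ η = curlOf D := by
  rw [LinearPMap.mem_graph_iff]
  have key : ∀ ξ : H1 P, (curlH1 P) ξ = curlOf fun i j => partialH1 P i j ξ := fun ξ => by
    ext1 i
    fin_cases i <;> rfl
  constructor
  · rintro ⟨ξ, rfl, rfl⟩
    exact ⟨(mem_H1.1 ξ.2).1, fun i j => partialH1 P i j ξ, fun i j => hasPartial_partialH1 i j ξ,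
      key ξ⟩
  · rintro ⟨h0, D, hD, rfl⟩
    refine ⟨⟨ξ, mem_H1.2 ⟨h0, D, hD⟩⟩, rfl, (key _).trans ?_⟩
    congr 1
    funext i j
    exact (hasPartial_partialH1 i j _).unique (hD i j)

theorem mem_graph_curl {ξ η : Vec P} : (ξ, η) ∈ (curl P).graph ↔
    ξ ∈ H2 P ∧ ∃ D : Fin 3 → Fin 3 → Scalar P,
      (∀ i j, HasPartial i (ξ j) (D i j)) ∧ η = curlOf D := by
  rw [curl, LinearPMap.mem_graph_domRestrict, mem_graph_curlH1]
  exact and_congr_right fun h => and_iff_right (mem_H1.1 (H2_le_H1 h)).1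

theorem mem_graph_grad {φ : Scalar P} {ξ : Vec P} : (φ, ξ) ∈ (grad P).graph ↔
    φ ∈ H20 P ∧ ∀ i, HasPartial i φ (ξ i) := by
  rw [grad, LinearPMap.mem_graph_domRestrict]
  refine and_congr_right fun hφ => ?_
  rw [LinearPMap.mem_graph_iff]
  constructor
  · rintro ⟨φ, rfl, rfl⟩ i
    exact hasPartial_generator ⟨φ.1, (mem_H10.1 φ.2).2.choose_spec i |>.mem⟩
  · intro h
    refine ⟨⟨φ, H20_le_H10 hφ⟩, rfl, ?_⟩
    ext1 i
    exact (h i).generator_eq (h i).mem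

end

end StationaryHelmholtz

namespace StationaryHelmholtz

/-! ### Integration by parts -/

section

variable {Ω : Type*} [MeasurableSpace Ω] [AddAction Space Ω] [MeasurableConstVAdd Space Ω]
  {P : Measure Ω} [VAddInvariantMeasure Space Ω P]

/-- Gradients are orthogonal to curls. -/
theorem inner_grad_curl (hT : StronglyContinuous P) {φ : Scalar P} {u A : Vec P}
    {D : Fin 3 → Fin 3 → Scalar P} {E : Fin 3 → Fin 3 → Fin 3 → Scalar P}
    (hu : ∀ i, HasPartial i φ (u i)) (hD : ∀ i j, HasPartial i (A j) (D i j))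
    (hE : ∀ i j k, HasPartial i (D j k) (E i j k)) : inner ℂ u (curlOf D) = 0 := by
  -- Only first derivatives of `φ` are available, so they are moved onto `A`, whose mixed second
  -- derivatives then cancel in pairs.
  have hs : ∀ i j k, E i j k = E j i k := fun i j k =>
    (hD i k).comm hT (hD j k) (hE i j k) (hE j i k)
  have h : ∀ i j k, inner ℂ (u i) (D j k) = -inner ℂ φ (E i j k) := fun i j k =>
    (hu i).inner_eq_neg (hE i j k)
  rw [inner_vec, curlOf_zero, curlOf_one, curlOf_two]
  simp only [inner_sub_right, h]
  rw [hs 1 0 2, hs 2 0 1, hs 2 1 0]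
  ring

/-- The curl is symmetric. -/
theorem inner_curlOf_left {A ξ : Vec P} {D F : Fin 3 → Fin 3 → Scalar P}
    (hD : ∀ i j, HasPartial i (A j) (D i j)) (hF : ∀ i j, HasPartial i (ξ j) (F i j)) :
    inner ℂ (curlOf D) ξ = inner ℂ A (curlOf F) := by
  have h : ∀ i j k, inner ℂ (D i j) (ξ k) = -inner ℂ (A j) (F i k) := fun i j k =>
    (hD i j).inner_eq_neg (hF i k)
  rw [inner_vec, inner_vec]
  simp only [curlOf_zero, curlOf_one, curlOf_two, inner_sub_right, inner_sub_left, h]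
  ring

theorem inner_grad_left {φ : Scalar P} {u ζ : Vec P} {D : Fin 3 → Fin 3 → Scalar P}
    (hu : ∀ i, HasPartial i φ (u i)) (hD : ∀ i j, HasPartial i (ζ j) (D i j)) :
    inner ℂ u ζ = inner ℂ φ (-∑ i, D i i) := by
  have h : ∀ i, inner ℂ (u i) (ζ i) = -inner ℂ φ (D i i) := fun i => (hu i).inner_eq_neg (hD i i)
  rw [inner_vec, Fin.sum_univ_three, inner_neg_right, inner_add_right, inner_add_right, h, h, h]
  ring

/-- A field which is weakly curl free is orthogonal to all curls. -/
theorem inner_curlOf_eq_zero {A ξ : Vec P} {D : Fin 3 → Fin 3 → Scalar P}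
    (hD : ∀ i j, HasPartial i (A j) (D i j))
    (hξ : ∀ (φ : Scalar P) (hφ : ∀ i, φ ∈ (generator P i).domain) (i j : Fin 3),
      inner ℂ (generator P i ⟨φ, hφ i⟩) (ξ j) - inner ℂ (generator P j ⟨φ, hφ j⟩) (ξ i) = 0) :
    inner ℂ (curlOf D) ξ = 0 := by
  -- The components of `A` themselves serve as test functions.
  have h : ∀ i j k, inner ℂ (D i k) (ξ j) = inner ℂ (D j k) (ξ i) := fun i j k => by
    have := hξ (A k) (fun i => (hD i k).mem) i j
    rwa [(hD i k).generator_eq, (hD j k).generator_eq, sub_eq_zero] at this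
  rw [inner_vec]
  simp only [curlOf_zero, curlOf_one, curlOf_two, inner_sub_left]
  rw [h 1 0 2, h 2 0 1, h 2 1 0]
  ring

/-- Gradients are weakly curl free. Second derivatives fall on `φ` alone, so `ψ` may be any function
of the common domain. -/
theorem inner_grad_symm (hT : StronglyContinuous P) {φ ψ : Scalar P} {u v : Fin 3 → Scalar P}
    {h : Fin 3 → Fin 3 → Scalar P} (hu : ∀ i, HasPartial i ψ (u i))
    (hv : ∀ i, HasPartial i φ (v i)) (hh : ∀ i j, HasPartial i (v j) (h i j)) (i j : Fin 3) :
    inner ℂ (u i) (v j) = inner ℂ (u j) (v i) := by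
  rw [(hu i).inner_eq_neg (hh i j), (hu j).inner_eq_neg (hh j i),
    (hv i).comm hT (hv j) (hh i j) (hh j i)]

/-- For a field with first derivatives the weak equation is the strong one, because the test
functions are dense. -/
theorem sum_eq_zero_of_weakly (hT : StronglyContinuous P) {ζ : Vec P}
    {D : Fin 3 → Fin 3 → Scalar P} (hD : ∀ i j, HasPartial i (ζ j) (D i j))
    (hζ : ∀ (φ : Scalar P) (hφ : ∀ i, φ ∈ (generator P i).domain),
      ∑ i, inner ℂ (generator P i ⟨φ, hφ i⟩) (ζ i) = 0) : -∑ i, D i i = 0 := by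
  refine eq_of_forall_hasPartial_inner_eq hT fun φ hφ => ?_
  choose u hu using hφ
  have h1 := hζ φ fun i => (hu i).mem
  have h2 := inner_grad_left (u := WithLp.toLp 2 u) hu hD
  rw [inner_zero_left, ← inner_conj_symm, ← h2, PiLp.inner_apply]
  simp only [fun i => (hu i).generator_eq (hu i).mem] at h1
  rw [h1, map_zero]

theorem eq_of_weakly (hT : StronglyContinuous P) {ξ : Vec P}
    {D : Fin 3 → Fin 3 → Scalar P} (hD : ∀ i j, HasPartial i (ξ j) (D i j))
    (hξ : ∀ (φ : Scalar P) (hφ : ∀ i, φ ∈ (generator P i).domain) (i j : Fin 3),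
      inner ℂ (generator P i ⟨φ, hφ i⟩) (ξ j) - inner ℂ (generator P j ⟨φ, hφ j⟩) (ξ i) = 0)
    (i j : Fin 3) : D i j = D j i := by
  refine eq_of_forall_hasPartial_inner_eq hT fun φ hφ => ?_
  choose u hu using hφ
  have h1 := hξ φ (fun i => (hu i).mem) i j
  rw [(hu i).generator_eq, (hu j).generator_eq, (hu i).inner_eq_neg (hD i j),
    (hu j).inner_eq_neg (hD j i), sub_eq_zero, neg_inj] at h1
  rw [← inner_conj_symm, h1, inner_conj_symm]

variable [IsProbabilityMeasure P]

/-- Each factor gains one derivative: the outer `A` commutes with the generators, so the first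
derivatives of `A (A f)` are again values of `A` and can be differentiated once more. -/
theorem mem_H20_of_comp {A : Scalar P →L[ℂ] Scalar P} (hA : CommutesTranslate A)
    (hA' : ∀ f i, ∃ g, HasPartial i (A f) g) {f : Scalar P}
    (h0 : A (A f) ∈ meanZero P) : A (A f) ∈ H20 P := by
  choose D hD using hA'
  exact mem_H20.2 ⟨h0, fun i => A (D f i), fun i j => D (D f j) i,
    fun i => hA.hasPartial (hD f i), fun i j => hD (D f j) i⟩

end

/-! ### Uniqueness, completeness and density -/

section

variable {Ω : Type*} [MeasurableSpace Ω] [AddAction Space Ω] [MeasurableConstVAdd Space Ω]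
  {P : Measure Ω} [IsProbabilityMeasure P] [ErgodicVAdd Space Ω P]

theorem eq_zero_of_hasPartial_zero {f : Scalar P} (hf : f ∈ meanZero P)
    (h : ∀ i, HasPartial i f 0) : f = 0 :=
  eq_zero_of_translate_eq (translate_eq_of_hasPartial_zero h) hf

/-- Integration by parts turns `‖∇f‖²` into `-⟪f, Δf⟫ = 0`, and a mean-zero function with zero
gradient vanishes. -/
theorem eq_zero_of_laplacian_eq_zero {f : Scalar P} (hf : f ∈ meanZero P) {g : Fin 3 → Scalar P}
    {h : Fin 3 → Fin 3 → Scalar P} (hg : ∀ i, HasPartial i f (g i))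
    (hh : ∀ i j, HasPartial i (g j) (h i j)) (h0 : ∑ i, h i i = 0) : f = 0 := by
  have h1 := inner_grad_left (u := WithLp.toLp 2 g) (ζ := WithLp.toLp 2 g) hg hh
  rw [h0, neg_zero, inner_zero_right, inner_self_eq_zero] at h1
  refine eq_zero_of_hasPartial_zero hf fun i => ?_
  have h2 : g i = 0 := congrArg (fun ξ : Vec P => ξ i) h1
  exact h2 ▸ hg i

/-- Each component has zero Laplacian: `∑ L_i L_i ζ_k = ∑ L_i L_k ζ_i = L_k ∑ L_i ζ_i = 0`, by
vanishing curl, commutation and vanishing divergence. -/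
theorem eq_zero_of_div_curl_eq_zero (hT : StronglyContinuous P) {ζ : Vec P} (hζ : ζ ∈ H2 P)
    {D : Fin 3 → Fin 3 → Scalar P} (hD : ∀ i j, HasPartial i (ζ j) (D i j))
    (hdiv : ∑ i, D i i = 0) (hcurl : ∀ i j, D i j = D j i) : ζ = 0 := by
  obtain ⟨h0, D', E, hD', hE⟩ := mem_H2.1 hζ
  obtain rfl : D = D' := by
    funext i j; exact (hD i j).unique (hD' i j)
  ext1 k
  refine eq_zero_of_laplacian_eq_zero (h0 k) (fun i => hD i k) (fun i j => hE i j k) ?_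
  have h1 : ∀ i, E i i k = E k i i := fun i => by
    have : E i i k = E i k i := (hE i i k).unique (hcurl i k ▸ hE i k i)
    rw [this]
    exact (hD i i).comm hT (hD k i) (hE i k i) (hE k i i)
  simp only [h1]
  have h2 : HasPartial k (∑ i, D i i) (∑ i, E k i i) := by
    simp only [Fin.sum_univ_three]
    exact ((hE k 0 0).add (hE k 1 1)).add (hE k 2 2)
  have h3 : HasPartial k (0 : Scalar P) 0 := by
    have := (hD k k).sub (hD k k)
    rwa [sub_self, sub_self] at this
  exact (hdiv ▸ h2).unique h3

/-- A mean-zero field orthogonal to all gradients and all curls vanishes. -/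
theorem eq_zero_of_inner_eq_zero (hT : StronglyContinuous P) {ζ : Vec P}
    (h0 : ζ ∈ vecOf (meanZero P))
    (hg : ∀ ξ ∈ (grad P).rangeSpace, inner ℂ ξ ζ = 0)
    (hc : ∀ ξ ∈ (curl P).rangeSpace, inner ℂ ξ ζ = 0) : ζ = 0 := by
  obtain ⟨A, hA, hA'⟩ := exists_isApproxIdentity_hasPartial hT
  have hreg : ∀ n f, f ∈ meanZero P → (A n (A n f)) ∈ H20 P := fun n f hf =>
    mem_H20_of_comp (hA.commutes n) (hA' n)
      ((hA.commutes n).mem_meanZero ((hA.commutes n).mem_meanZero hf))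
  have hlim := (hA.comp hA).tendsto
  simp only [ContinuousLinearMap.comp_apply] at hlim
  -- The smoothings of `d` lie in `H20` and tend to `d`, so `⟪d, d⟫ = 0`.
  have hself : ∀ {d : Scalar P}, d ∈ meanZero P → (∀ φ ∈ H20 P, inner ℂ φ d = 0) → d = 0 := by
    intro d hd h
    have h1 := (hlim d).inner (𝕜 := ℂ) (tendsto_const_nhds (x := d))
    simp only [h _ (hreg _ d hd)] at h1
    exact inner_self_eq_zero.1 (tendsto_nhds_unique h1 tendsto_const_nhds)
  have hzero : ∀ n, mapVec (A n ∘L A n) ζ = 0 := by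
    intro n
    set B := A n ∘L A n
    have hBc : CommutesTranslate B := (hA.commutes n).comp (hA.commutes n)
    have hin : ∀ η, inner ℂ η (mapVec B ζ) = inner ℂ (mapVec B.adjoint η) ζ := fun η =>
      (inner_mapVec_left (fun f g => ContinuousLinearMap.adjoint_inner_left B g f) η ζ).symm
    have hmem : mapVec B ζ ∈ H2 P := fun i => hreg n _ (h0 i)
    obtain ⟨hm, D, E, hD, hE⟩ := mem_H2.1 hmem
    -- The adjoint also commutes with translations, so it preserves `H20` and sends gradients to
    -- gradients and curls to curls. Testing the smoothed field thus reduces to testing `ζ`.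
    have hadj20 : ∀ {φ}, φ ∈ H20 P → B.adjoint φ ∈ H20 P := by
      intro φ hφ
      obtain ⟨hφ0, g, h, hg, hh⟩ := mem_H20.1 hφ
      exact mem_H20.2 ⟨hBc.adjoint.mem_meanZero hφ0, _, _,
        fun i => hBc.adjoint.hasPartial (hg i), fun i j => hBc.adjoint.hasPartial (hh i j)⟩
    refine eq_zero_of_div_curl_eq_zero hT hmem hD ?_ ?_
    · refine hself (Submodule.sum_mem _ fun i _ => (hD i i).mem_meanZero) fun φ hφ => ?_
      obtain ⟨hφ0, g, h, hgφ, hh⟩ := mem_H20.1 hφ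
      have h1 := inner_grad_left (u := WithLp.toLp 2 g) hgφ hD
      rw [hin, hg _ (LinearPMap.mem_rangeSpace.2 ⟨B.adjoint φ, mem_graph_grad.2
        ⟨hadj20 hφ, fun i => hBc.adjoint.hasPartial (hgφ i)⟩⟩), inner_neg_right] at h1
      exact neg_eq_zero.1 h1.symm
    · rw [← curlOf_eq_zero_iff]
      have hcz : ∀ A' ∈ H2 P, inner ℂ A' (curlOf D) = 0 := by
        intro A' hA'
        obtain ⟨_, F, _, hF, _⟩ := mem_H2.1 hA'
        rw [← inner_curlOf_left hF hD, hin]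
        refine hc _ (LinearPMap.mem_rangeSpace.2 ⟨mapVec B.adjoint A', mem_graph_curl.2
          ⟨fun i => hadj20 (hA' i), fun i j => B.adjoint (F i j),
            fun i j => hBc.adjoint.hasPartial (hF i j), mapVec_curlOf _ _⟩⟩)
      ext1 i
      refine hself ?_ fun φ hφ => ?_
      · fin_cases i <;> exact Submodule.sub_mem _ (hD _ _).mem_meanZero (hD _ _).mem_meanZero
      -- A test field whose only nonzero component is `φ` isolates the `i`-th component of the curl.
      · have h1 := hcz (WithLp.toLp 2 (Pi.single i φ)) fun k => by
          by_cases hk : k = i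
          · subst hk; simpa using hφ
          · simp [hk]
        rw [PiLp.inner_apply, Finset.sum_eq_single i] at h1
        · simpa using h1
        · intro k _ hk; simp [hk]
        · simp
  refine tendsto_nhds_unique (tendsto_vec (l := atTop) (u := fun n => mapVec (A n ∘L A n) ζ)
    fun i => ?_) ?_
  · exact hlim (ζ i)
  · simp only [hzero]
    exact tendsto_const_nhds

/-- Having mean zero is a closed condition, and smoothing a mean-zero field twice approximates it
from within `H2`. -/
theorem H2bar_eq (hT : StronglyContinuous P) : H2bar P = vecOf (meanZero P) := by
  refine le_antisymm (Submodule.topologicalClosure_minimal _ (fun ξ hξ => (mem_H2.1 hξ).1)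
    (isClosed_vecOf isClosed_meanZero)) fun ξ hξ => ?_
  obtain ⟨A, hA, hA'⟩ := exists_isApproxIdentity_hasPartial hT
  have hlim := (hA.comp hA).tendsto
  refine mem_closure_of_tendsto (tendsto_vec (l := atTop) (u := fun n => mapVec (A n ∘L A n) ξ)
    fun i => hlim (ξ i)) (Eventually.of_forall fun n i => ?_)
  exact mem_H20_of_comp (hA.commutes n) (hA' n)
    ((hA.commutes n).mem_meanZero ((hA.commutes n).mem_meanZero (hξ i)))

end

end StationaryHelmholtz

namespace StationaryHelmholtz

/-! ### Translation-invariant projections, and weak kernels -/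

section

variable {Ω : Type*} [MeasurableSpace Ω] [AddAction Space Ω] [MeasurableConstVAdd Space Ω]
  {P : Measure Ω} [VAddInvariantMeasure Space Ω P]

theorem hasDerivAt_vec {i : Fin 3} {ξ η : Vec P} (h : ∀ k, HasPartial i (ξ k) (η k)) :
    HasDerivAt (fun t : ℝ => mapVec (translate P
      (t • EuclideanSpace.single i (1 : ℝ))).toContinuousLinearMap ξ) η 0 :=
  (PiLp.continuousLinearEquiv 2 ℝ
    (fun _ : Fin 3 => Scalar P)).symm.toContinuousLinearMap.hasFDerivAt.comp_hasDerivAt 0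
      (hasDerivAt_pi.2 h)

/-- A bounded operator on vector fields that commutes with the translations maps the domain of each
generator into itself and commutes with the generator. -/
theorem hasPartial_of_comm {p : Vec P →L[ℂ] Vec P}
    (hp : ∀ x ξ, p (mapVec (translate P x).toContinuousLinearMap ξ) =
      mapVec (translate P x).toContinuousLinearMap (p ξ))
    {i : Fin 3} {ξ η : Vec P} (h : ∀ k, HasPartial i (ξ k) (η k)) (k : Fin 3) :
    HasPartial i (p ξ k) (p η k) := by
  have h1 := ((PiLp.proj 2 (fun _ : Fin 3 => Scalar P) k ∘L p).restrictScalars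
    ℝ).hasFDerivAt.comp_hasDerivAt 0 (hasDerivAt_vec h)
  refine h1.congr_of_eventuallyEq (Eventually.of_forall fun t => ?_)
  exact (congrArg (fun ξ : Vec P => ξ k) (hp _ ξ)).symm

theorem starProjection_translate {K : Submodule ℂ (Vec P)} [K.HasOrthogonalProjection]
    (hK : ∀ x, ∀ ξ ∈ K, mapVec (translate P x).toContinuousLinearMap ξ ∈ K) (x : Space)
    (ξ : Vec P) : K.starProjection (mapVec (translate P x).toContinuousLinearMap ξ) =
      mapVec (translate P x).toContinuousLinearMap (K.starProjection ξ) :=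
  Submodule.starProjection_comm_of_mapsTo
    (inner_mapVec_left (C := (translate P (-x)).toContinuousLinearMap)
      fun f g => inner_translate_left x f g) (hK x) (hK (-x)) ξ

variable [IsProbabilityMeasure P]

theorem translate_mem_H20 {φ : Scalar P} (hφ : φ ∈ H20 P) (x : Space) :
    translate P x φ ∈ H20 P := by
  obtain ⟨h0, g, h, hg, hh⟩ := mem_H20.1 hφ
  exact mem_H20.2 ⟨translate_mem_meanZero h0 x, _, _, fun i => (hg i).translate x,
    fun i j => (hh i j).translate x⟩

theorem translate_mem_gradRange (x : Space) {ξ : Vec P} (hξ : ξ ∈ gradRange P) :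
    mapVec (translate P x).toContinuousLinearMap ξ ∈ gradRange P := by
  refine ContinuousLinearMap.map_mem_topologicalClosure (fun ξ hξ => ?_) hξ
  obtain ⟨φ, hφ⟩ := LinearPMap.mem_rangeSpace.1 hξ
  obtain ⟨h2, hp⟩ := mem_graph_grad.1 hφ
  exact LinearPMap.mem_rangeSpace.2 ⟨_, mem_graph_grad.2
    ⟨translate_mem_H20 h2 x, fun i => (hp i).translate x⟩⟩

theorem translate_mem_curlRange (x : Space) {ξ : Vec P} (hξ : ξ ∈ curlRange P) :
    mapVec (translate P x).toContinuousLinearMap ξ ∈ curlRange P := by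
  refine ContinuousLinearMap.map_mem_topologicalClosure (fun ξ hξ => ?_) hξ
  obtain ⟨A, hA⟩ := LinearPMap.mem_rangeSpace.1 hξ
  obtain ⟨h2, D, hD, rfl⟩ := mem_graph_curl.1 hA
  exact LinearPMap.mem_rangeSpace.2 ⟨mapVec (translate P x).toContinuousLinearMap A,
    mem_graph_curl.2 ⟨fun i => translate_mem_H20 (h2 i) x, _, fun i j => (hD i j).translate x,
      mapVec_curlOf _ _⟩⟩

/-- The projection onto a translation-invariant subspace commutes with translations, hence with the
generators: the derivatives of the projected field are the projections of the derivatives. -/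
theorem starProjection_mem_H2 {K : Submodule ℂ (Vec P)} [K.HasOrthogonalProjection]
    (hK : ∀ x, ∀ ξ ∈ K, mapVec (translate P x).toContinuousLinearMap ξ ∈ K)
    (hK0 : K ≤ vecOf (meanZero P)) {ξ : Vec P} (hξ : ξ ∈ H2 P) : K.starProjection ξ ∈ H2 P := by
  obtain ⟨_, D, E, hD, hE⟩ := mem_H2.1 hξ
  have hp := starProjection_translate hK
  exact mem_H2.2 ⟨hK0 (Submodule.starProjection_apply_mem _ _),
    fun i k => K.starProjection (WithLp.toLp 2 (D i)) k,
    fun i j k => K.starProjection (WithLp.toLp 2 (E i j)) k,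
    fun i k => hasPartial_of_comm hp (fun k => hD i k) k,
    fun i j k => hasPartial_of_comm hp (ξ := WithLp.toLp 2 (D j)) (fun k => hE i j k) k⟩

theorem inner_grad_eq_inner_gradStar {φ d : Scalar P} {u ζ : Vec P}
    (h : (φ, u) ∈ (grad P).graph) (h' : (ζ, d) ∈ (gradStar P).graph) :
    inner ℂ u ζ = inner ℂ φ d := by
  obtain ⟨_, D, hD, rfl⟩ := mem_graph_gradStar.1 h'
  exact inner_grad_left (mem_graph_grad.1 h).2 hD

theorem inner_curl_eq_inner_curl {A η ξ ζ : Vec P}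
    (h : (A, η) ∈ (curl P).graph) (h' : (ξ, ζ) ∈ (curlH1 P).graph) :
    inner ℂ η ξ = inner ℂ A ζ := by
  obtain ⟨_, D, hD, rfl⟩ := mem_graph_curl.1 h
  obtain ⟨_, F, hF, rfl⟩ := mem_graph_curlH1.1 h'
  exact inner_curlOf_left hD hF

theorem curl_le_curlH1 {A η : Vec P} (h : (A, η) ∈ (curl P).graph) :
    (A, η) ∈ (curlH1 P).graph := LinearPMap.le_graph_of_le LinearPMap.domRestrict_le h

/-- The divergence of a curl vanishes. -/
theorem gradStar_curl (hT : StronglyContinuous P) {A η : Vec P} (h : (A, η) ∈ (curl P).graph) :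
    (η, 0) ∈ (gradStar P).graph := by
  obtain ⟨h2, D, hD, rfl⟩ := mem_graph_curl.1 h
  obtain ⟨h0, D', E, hD', hE⟩ := mem_H2.1 h2
  obtain rfl : D = D' := by
    funext i j; exact (hD i j).unique (hD' i j)
  have hs : ∀ i j k, E i j k = E j i k := fun i j k =>
    (hD i k).comm hT (hD j k) (hE i j k) (hE j i k)
  refine mem_graph_gradStar.2 ⟨fun i => ?_, fun i j => curlOf (E i) j, fun i j => ?_, ?_⟩
  · fin_cases i <;> exact Submodule.sub_mem _ (hD _ _).mem_meanZero (hD _ _).mem_meanZero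
  · fin_cases j <;> exact (hE i _ _).sub (hE i _ _)
  · simp only [Fin.sum_univ_three]
    rw [curlOf_zero, curlOf_one, curlOf_two, hs 1 0 2, hs 2 0 1, hs 2 1 0]
    abel

/-- The curl of a gradient vanishes. -/
theorem curlH1_grad (hT : StronglyContinuous P) {φ : Scalar P} {u : Vec P}
    (h : (φ, u) ∈ (grad P).graph) : (u, 0) ∈ (curlH1 P).graph := by
  obtain ⟨h2, hu⟩ := mem_graph_grad.1 h
  obtain ⟨_, g, E, hg, hE⟩ := mem_H20.1 h2
  have hgu : ∀ i, g i = u i := fun i => (hg i).unique (hu i)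
  refine mem_graph_curlH1.2 ⟨fun i => (hu i).mem_meanZero, E, fun i j => hgu j ▸ hE i j, ?_⟩
  exact (curlOf_eq_zero_iff.2 fun i j => (hg i).comm hT (hg j) (hE i j) (hE j i)).symm

theorem exists_gradStar {ζ : Vec P} (h : ζ ∈ H1 P) : ∃ d, (ζ, d) ∈ (gradStar P).graph :=
  LinearPMap.mem_domain_iff.1 h

theorem exists_curlH1 {ζ : Vec P} (h : ζ ∈ H1 P) : ∃ η, (ζ, η) ∈ (curlH1 P).graph :=
  LinearPMap.mem_domain_iff.1 h

theorem mem_H1_of_gradStar {ζ : Vec P} {d : Scalar P} (h : (ζ, d) ∈ (gradStar P).graph) :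
    ζ ∈ H1 P := LinearPMap.mem_domain_of_mem_graph h

theorem mem_H1_of_curlH1 {ζ η : Vec P} (h : (ζ, η) ∈ (curlH1 P).graph) :
    ζ ∈ H1 P := LinearPMap.mem_domain_of_mem_graph h

theorem gradRange_le : gradRange P ≤ vecOf (meanZero P) := by
  refine Submodule.topologicalClosure_minimal _ (fun ξ hξ => ?_) (isClosed_vecOf isClosed_meanZero)
  obtain ⟨φ, hφ⟩ := LinearPMap.mem_rangeSpace.1 hξ
  exact fun i => ((mem_graph_grad.1 hφ).2 i).mem_meanZero

theorem curlRange_le (hT : StronglyContinuous P) : curlRange P ≤ vecOf (meanZero P) := by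
  refine Submodule.topologicalClosure_minimal _ (fun ξ hξ => ?_) (isClosed_vecOf isClosed_meanZero)
  obtain ⟨A, hA⟩ := LinearPMap.mem_rangeSpace.1 hξ
  exact (mem_graph_gradStar.1 (gradStar_curl hT hA)).1

theorem mem_gradRange_orthogonal {ξ : Vec P} :
    ξ ∈ (gradRange P)ᗮ ↔ ∀ φ u, (φ, u) ∈ (grad P).graph → inner ℂ u ξ = 0 := by
  rw [gradRange, Submodule.orthogonal_closure, Submodule.mem_orthogonal]
  simp only [LinearPMap.mem_rangeSpace]
  exact ⟨fun h φ u hu => h u ⟨φ, hu⟩, fun h u ⟨φ, hu⟩ => h φ u hu⟩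

theorem mem_curlRange_orthogonal {ξ : Vec P} :
    ξ ∈ (curlRange P)ᗮ ↔ ∀ A η, (A, η) ∈ (curl P).graph → inner ℂ η ξ = 0 := by
  rw [curlRange, Submodule.orthogonal_closure, Submodule.mem_orthogonal]
  simp only [LinearPMap.mem_rangeSpace]
  exact ⟨fun h φ u hu => h u ⟨φ, hu⟩, fun h u ⟨φ, hu⟩ => h φ u hu⟩

theorem mem_gradRange_orthogonal_of_gradStar {ζ : Vec P} (h : (ζ, 0) ∈ (gradStar P).graph) :
    ζ ∈ (gradRange P)ᗮ := mem_gradRange_orthogonal.2 fun _ _ hu => by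
  rw [inner_grad_eq_inner_gradStar hu h, inner_zero_right]

theorem mem_curlRange_orthogonal_of_curlH1 {ξ : Vec P} (h : (ξ, 0) ∈ (curlH1 P).graph) :
    ξ ∈ (curlRange P)ᗮ := mem_curlRange_orthogonal.2 fun _ _ hu => by
  rw [inner_curl_eq_inner_curl hu h, inner_zero_right]

theorem gradRange_isOrtho_curlRange (hT : StronglyContinuous P) :
    gradRange P ⟂ curlRange P :=
  Submodule.topologicalClosure_minimal _ (fun _ hξ =>
    let ⟨_, hφ⟩ := LinearPMap.mem_rangeSpace.1 hξ
    mem_curlRange_orthogonal_of_curlH1 (curlH1_grad hT hφ)) (Submodule.isClosed_orthogonal _)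

theorem isWeaklyDivFree_of_mem_curlRange (hT : StronglyContinuous P) {ζ : Vec P}
    (hζ : ζ ∈ curlRange P) : IsWeaklyDivFree P ζ := by
  refine ⟨curlRange_le hT hζ, fun φ hφ => ?_⟩
  -- The weak condition says that this gradient is orthogonal to `ζ`. As `φ` need not lie in `H20`,
  -- orthogonality is checked directly on curls, and passes to their closure.
  set u : Vec P := WithLp.toLp 2 fun i => generator P i ⟨φ, hφ i⟩
  have h1 : u ∈ (curlRange P)ᗮ := mem_curlRange_orthogonal.2 fun A η hA => by
    obtain ⟨h2, D, hD, rfl⟩ := mem_graph_curl.1 hA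
    obtain ⟨h0, D', E, hD', hE⟩ := mem_H2.1 h2
    obtain rfl : D = D' := by
      funext i j; exact (hD i j).unique (hD' i j)
    rw [← inner_conj_symm, inner_grad_curl hT (fun i => hasPartial_generator ⟨φ, hφ i⟩) hD hE,
      map_zero]
  have h2 := Submodule.inner_left_of_mem_orthogonal hζ h1
  rwa [PiLp.inner_apply] at h2

theorem isWeaklyCurlFree_of_mem_gradRange (hT : StronglyContinuous P) {ξ : Vec P}
    (hξ : ξ ∈ gradRange P) : IsWeaklyCurlFree P ξ := by
  refine ⟨gradRange_le hξ, fun φ hφ i j => ?_⟩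
  set u : Fin 3 → Scalar P := fun i => generator P i ⟨φ, hφ i⟩
  -- The weak curl condition for `i, j` is orthogonality to one fixed field, with `u i` in slot `j`
  -- and `-u j` in slot `i` (zero when `i = j`). It therefore need only be checked on gradients and
  -- passes to the closure.
  have hv : ∀ ζ : Vec P, inner ℂ (WithLp.toLp 2 (Pi.single j (u i)) -
      WithLp.toLp 2 (Pi.single i (u j)) : Vec P) ζ = inner ℂ (u i) (ζ j) - inner ℂ (u j) (ζ i) := by
    have hs : ∀ (k : Fin 3) (f : Scalar P) (ζ : Vec P),
        inner ℂ (WithLp.toLp 2 (Pi.single k f) : Vec P) ζ = inner ℂ f (ζ k) := fun k f ζ => by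
      rw [PiLp.inner_apply, Finset.sum_eq_single k]
      · simp
      · intro l _ hl; simp [hl]
      · simp
    intro ζ
    rw [inner_sub_left, hs, hs]
  rw [← hv]
  refine Submodule.inner_left_of_mem_orthogonal hξ (mem_gradRange_orthogonal.2 fun ψ w hw => ?_)
  obtain ⟨h2, hw⟩ := mem_graph_grad.1 hw
  obtain ⟨_, g, E, hg, hE⟩ := mem_H20.1 h2
  have hgw : ∀ i, g i = w i := fun i => (hg i).unique (hw i)
  rw [← inner_conj_symm, hv, ← hgw, ← hgw,
    inner_grad_symm hT (fun i => hasPartial_generator ⟨φ, hφ i⟩) hg hE i j, sub_self, map_zero]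

theorem mem_gradRange_orthogonal_of_weakly {ζ : Vec P} (hζ : IsWeaklyDivFree P ζ) :
    ζ ∈ (gradRange P)ᗮ := mem_gradRange_orthogonal.2 fun φ u hu => by
  have hp := (mem_graph_grad.1 hu).2
  have h := hζ.2 φ fun i => (hp i).mem
  simp only [fun i => (hp i).generator_eq (hp i).mem] at h
  rw [PiLp.inner_apply, h]

theorem mem_curlRange_orthogonal_of_weakly {ξ : Vec P} (hξ : IsWeaklyCurlFree P ξ) :
    ξ ∈ (curlRange P)ᗮ := mem_curlRange_orthogonal.2 fun A η hA => by
  obtain ⟨_, D, hD, rfl⟩ := mem_graph_curl.1 hA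
  exact inner_curlOf_eq_zero hD hξ.2

theorem gradStar_of_mem_curlRange (hT : StronglyContinuous P) {ζ : Vec P} (h1 : ζ ∈ H1 P)
    (hζ : ζ ∈ curlRange P) : (ζ, 0) ∈ (gradStar P).graph := by
  obtain ⟨h0, D, hD⟩ := mem_H1.1 h1
  exact mem_graph_gradStar.2 ⟨h0, D, hD,
    (sum_eq_zero_of_weakly hT hD (isWeaklyDivFree_of_mem_curlRange hT hζ).2).symm⟩

theorem curl_of_mem_gradRange (hT : StronglyContinuous P) {ξ : Vec P} (h2 : ξ ∈ H2 P)
    (hξ : ξ ∈ gradRange P) : (ξ, 0) ∈ (curl P).graph := by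
  obtain ⟨_, D, hD⟩ := mem_H1.1 (H2_le_H1 h2)
  exact mem_graph_curl.2 ⟨h2, D, hD, (curlOf_eq_zero_iff.2
    (eq_of_weakly hT hD (isWeaklyCurlFree_of_mem_gradRange hT hξ).2)).symm⟩

theorem gradProjection_mem_H2 {ξ : Vec P} (hξ : ξ ∈ H2 P) :
    (gradRange P).starProjection ξ ∈ H2 P :=
  starProjection_mem_H2 (fun x _ h => translate_mem_gradRange x h) gradRange_le hξ

theorem curlProjection_mem_H2 (hT : StronglyContinuous P) {ξ : Vec P} (hξ : ξ ∈ H2 P) :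
    (curlRange P).starProjection ξ ∈ H2 P :=
  starProjection_mem_H2 (fun x _ h => translate_mem_curlRange x h) (curlRange_le hT) hξ

end

/-! ### The Helmholtz decomposition and the two projection formulas -/

section

variable {Ω : Type*} [MeasurableSpace Ω] [AddAction Space Ω] [MeasurableConstVAdd Space Ω]
  {P : Measure Ω} [IsProbabilityMeasure P] [ErgodicVAdd Space Ω P]

/-- If `∇*∇φ = 0`, then `‖∇φ‖² = ⟪φ, ∇*∇φ⟫ = 0`, and ergodicity forces `φ = 0`. -/
theorem gradStarGrad_kernel : (gradStarGrad P).kernel = ⊥ := by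
  refine (Submodule.eq_bot_iff _).2 fun φ hφ => ?_
  obtain ⟨u, hu, hd⟩ := LinearPMap.mem_graph_pcomp.1 (LinearPMap.mem_kernel.1 hφ)
  have h := inner_grad_eq_inner_gradStar hu hd
  rw [inner_zero_right, inner_self_eq_zero] at h
  subst h
  obtain ⟨h2, hp⟩ := mem_graph_grad.1 hu
  exact eq_zero_of_hasPartial_zero (mem_H20.1 h2).1 hp

theorem mem_graph_curlCurl {A ζ : Vec P} : (A, ζ) ∈ (curlCurl P).graph ↔
    A ∈ H2 P ∧ (A, 0) ∈ (gradStar P).graph ∧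
      ∃ η, (A, η) ∈ (curl P).graph ∧ (η, ζ) ∈ (curlH1 P).graph := by
  rw [curlCurl, LinearPMap.mem_graph_domRestrict, LinearPMap.mem_graph_pcomp, Submodule.mem_inf,
    LinearPMap.mem_kernel, and_assoc]

/-- Symmetry of the curl gives `‖∇×A‖² = ⟪A, ∇×∇×A⟫ = 0`; the restriction to `∇*A = 0` then makes
`A` both divergence free and curl free. -/
theorem curlCurl_kernel (hT : StronglyContinuous P) : (curlCurl P).kernel = ⊥ := by
  refine (Submodule.eq_bot_iff _).2 fun A hA => ?_
  obtain ⟨h2, hd, η, hc, hcc⟩ := mem_graph_curlCurl.1 (LinearPMap.mem_kernel.1 hA)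
  have h := inner_curl_eq_inner_curl hc hcc
  rw [inner_zero_right, inner_self_eq_zero] at h
  subst h
  obtain ⟨_, D, hD, h0⟩ := mem_graph_curl.1 hc
  obtain ⟨_, D', hD', h0'⟩ := mem_graph_gradStar.1 hd
  obtain rfl : D = D' := by
    funext i j; exact (hD i j).unique (hD' i j)
  exact eq_zero_of_div_curl_eq_zero hT h2 hD (neg_eq_zero.1 h0'.symm)
    (curlOf_eq_zero_iff.1 h0.symm)

/-- The Helmholtz decomposition of a mean-zero field. -/
theorem gradProjection_add_curlProjection (hT : StronglyContinuous P) {ξ : Vec P}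
    (hξ : ξ ∈ vecOf (meanZero P)) :
    (gradRange P).starProjection ξ + (curlRange P).starProjection ξ = ξ := by
  set g := (gradRange P).starProjection ξ
  set c := (curlRange P).starProjection ξ
  have hgm : g ∈ gradRange P := Submodule.starProjection_apply_mem _ _
  have hcm : c ∈ curlRange P := Submodule.starProjection_apply_mem _ _
  have ho := gradRange_isOrtho_curlRange hT
  -- Since the two ranges are orthogonal, removing both projections leaves a remainder orthogonal to
  -- both, and completeness makes it zero.
  have h1 : ξ - g - c ∈ (gradRange P)ᗮ := Submodule.sub_mem _
    (Submodule.sub_starProjection_mem_orthogonal ξ) (ho.symm hcm)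
  have h2 : ξ - c - g ∈ (curlRange P)ᗮ := Submodule.sub_mem _
    (Submodule.sub_starProjection_mem_orthogonal ξ) (ho hgm)
  rw [sub_right_comm] at h2
  have h3 : ξ - g - c = 0 := by
    refine eq_zero_of_inner_eq_zero hT (Submodule.sub_mem _ (Submodule.sub_mem _ hξ
      (gradRange_le hgm)) (curlRange_le hT hcm)) (fun u hu => ?_) fun u hu => ?_
    · exact Submodule.inner_right_of_mem_orthogonal (Submodule.le_topologicalClosure _ hu) h1
    · exact Submodule.inner_right_of_mem_orthogonal (Submodule.le_topologicalClosure _ hu) h2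
  rw [sub_sub, sub_eq_zero] at h3
  exact h3.symm

theorem mem_curlRange_of_mem_orthogonal (hT : StronglyContinuous P) {ζ : Vec P}
    (h0 : ζ ∈ vecOf (meanZero P)) (h : ζ ∈ (gradRange P)ᗮ) : ζ ∈ curlRange P := by
  have h1 := gradProjection_add_curlProjection hT h0
  rw [(Submodule.starProjection_apply_eq_zero_iff _).2 h, zero_add] at h1
  exact Submodule.starProjection_eq_self_iff.1 h1

theorem mem_gradRange_of_mem_orthogonal (hT : StronglyContinuous P) {ξ : Vec P}
    (h0 : ξ ∈ vecOf (meanZero P)) (h : ξ ∈ (curlRange P)ᗮ) : ξ ∈ gradRange P := by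
  have h1 := gradProjection_add_curlProjection hT h0
  rw [(Submodule.starProjection_apply_eq_zero_iff _).2 h, add_zero] at h1
  exact Submodule.starProjection_eq_self_iff.1 h1

theorem gradRange_sup_curlRange (hT : StronglyContinuous P) :
    gradRange P ⊔ curlRange P = H2bar P := by
  rw [H2bar_eq hT]
  refine le_antisymm (sup_le gradRange_le (curlRange_le hT)) fun ξ hξ => ?_
  rw [← gradProjection_add_curlProjection hT hξ]
  exact Submodule.add_mem_sup (Submodule.starProjection_apply_mem _ _)
    (Submodule.starProjection_apply_mem _ _)

/-- A submodule of `𝓗¹` which contains all gradients and all curls is dense in the completion of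
`𝓗²`. -/
theorem topologicalClosure_eq_H2bar (hT : StronglyContinuous P) {S : Submodule ℂ (Vec P)}
    (hS : S ≤ H1 P) (hg : (grad P).rangeSpace ≤ S) (hc : (curl P).rangeSpace ≤ S) :
    S.topologicalClosure = H2bar P := by
  refine le_antisymm ?_ ?_
  · rw [H2bar_eq hT]
    exact Submodule.topologicalClosure_minimal _ (fun ξ hξ => (mem_H1.1 (hS hξ)).1)
      (isClosed_vecOf isClosed_meanZero)
  · rw [← gradRange_sup_curlRange hT]
    exact sup_le (Submodule.topologicalClosure_mono hg) (Submodule.topologicalClosure_mono hc)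

/-- If `x` is sent to `y`, then `y` is a gradient and `x - y` is divergence free, hence orthogonal
to gradients. The domain is dense because it contains every gradient, which is its own image, and
every curl, whose image is `0`. -/
theorem Gam_eq (hT : StronglyContinuous P) :
    Gam P = (gradRange P).starProjection.toLinearMap.toPMap (H2bar P) := by
  have hgraph : ∀ {x y : Vec P}, (x, y) ∈ ((grad P).pcomp
      ((gradStarGrad P).inverse.pcomp (gradStar P))).graph ↔
      ∃ φ d, (x, d) ∈ (gradStar P).graph ∧ (φ, y) ∈ (grad P).graph ∧
        (y, d) ∈ (gradStar P).graph := fun {x y} => by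
    simp only [LinearPMap.mem_graph_pcomp, LinearPMap.mem_graph_inverse gradStarGrad_kernel]
    simp only [gradStarGrad, LinearPMap.mem_graph_pcomp]
    constructor
    · rintro ⟨φ, ⟨d, hx, u, hu, hd⟩, hy⟩
      obtain rfl : u = y := LinearPMap.mem_graph_snd_inj _ hu hy rfl
      exact ⟨φ, d, hx, hy, hd⟩
    · rintro ⟨φ, d, hx, hy, hd⟩
      exact ⟨φ, ⟨d, hx, y, hy, hd⟩, hy⟩
  refine LinearPMap.closure_eq_toPMap (fun x y hxy => ?_) (topologicalClosure_eq_H2bar hT ?_ ?_ ?_)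
  · obtain ⟨φ, d, hx, hy, hd⟩ := hgraph.1 hxy
    have h1 : (x - y, 0) ∈ (gradStar P).graph := by
      simpa using Submodule.sub_mem _ hx hd
    exact (Submodule.eq_starProjection_of_mem_orthogonal
      (Submodule.le_topologicalClosure _ (LinearPMap.mem_rangeSpace.2 ⟨φ, hy⟩))
      (mem_gradRange_orthogonal_of_gradStar h1)).symm
  · intro x hx
    obtain ⟨y, hy⟩ := LinearPMap.mem_domain_iff.1 hx
    obtain ⟨_, _, h, _⟩ := hgraph.1 hy
    exact mem_H1_of_gradStar h
  · intro u hu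
    obtain ⟨φ, hφ⟩ := LinearPMap.mem_rangeSpace.1 hu
    obtain ⟨d, hd⟩ := exists_gradStar (mem_H1_of_curlH1 (curlH1_grad hT hφ))
    exact LinearPMap.mem_domain_of_mem_graph (hgraph.2 ⟨φ, d, hd, hφ, hd⟩)
  · intro η hη
    obtain ⟨A, hA⟩ := LinearPMap.mem_rangeSpace.1 hη
    exact LinearPMap.mem_domain_of_mem_graph (y := 0) (hgraph.2 ⟨0, 0, gradStar_curl hT hA,
      Submodule.zero_mem _, Submodule.zero_mem _⟩)

/-- The argument is that for `Gam` with the roles exchanged, except that a curl lies in the domain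
only if it has a divergence-free potential in `H2`. -/
theorem Ups_eq (hT : StronglyContinuous P) :
    Ups P = (curlRange P).starProjection.toLinearMap.toPMap (H2bar P) := by
  have hgraph : ∀ {x y : Vec P}, (x, y) ∈ ((curl P).pcomp
      ((curlCurl P).inverse.pcomp (curlH1 P))).graph ↔
      ∃ A c, (x, c) ∈ (curlH1 P).graph ∧ (A, 0) ∈ (gradStar P).graph ∧ (A, y) ∈ (curl P).graph ∧
        (y, c) ∈ (curlH1 P).graph := fun {x y} => by
    simp only [LinearPMap.mem_graph_pcomp, LinearPMap.mem_graph_inverse (curlCurl_kernel hT),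
      mem_graph_curlCurl]
    constructor
    · rintro ⟨A, ⟨c, hx, _, h0, u, hu, hc⟩, hy⟩
      obtain rfl : u = y := LinearPMap.mem_graph_snd_inj _ hu hy rfl
      exact ⟨A, c, hx, h0, hy, hc⟩
    · rintro ⟨A, c, hx, h0, hy, hc⟩
      exact ⟨A, ⟨c, hx, (mem_graph_curl.1 hy).1, h0, y, hy, hc⟩, hy⟩
  refine LinearPMap.closure_eq_toPMap (fun x y hxy => ?_) (topologicalClosure_eq_H2bar hT ?_ ?_ ?_)
  · obtain ⟨A, c, hx, _, hy, hc⟩ := hgraph.1 hxy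
    have h1 : (x - y, 0) ∈ (curlH1 P).graph := by
      simpa using Submodule.sub_mem _ hx hc
    exact (Submodule.eq_starProjection_of_mem_orthogonal
      (Submodule.le_topologicalClosure _ (LinearPMap.mem_rangeSpace.2 ⟨A, hy⟩))
      (mem_curlRange_orthogonal_of_curlH1 h1)).symm
  · intro x hx
    obtain ⟨y, hy⟩ := LinearPMap.mem_domain_iff.1 hx
    obtain ⟨_, _, h, _⟩ := hgraph.1 hy
    exact mem_H1_of_curlH1 h
  · intro u hu
    obtain ⟨φ, hφ⟩ := LinearPMap.mem_rangeSpace.1 hu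
    exact LinearPMap.mem_domain_of_mem_graph (y := 0) (hgraph.2 ⟨0, 0, curlH1_grad hT hφ,
      Submodule.zero_mem _, Submodule.zero_mem _, Submodule.zero_mem _⟩)
  · intro η hη
    obtain ⟨A, hA⟩ := LinearPMap.mem_rangeSpace.1 hη
    obtain ⟨c, hc⟩ := exists_curlH1 (mem_H1_of_gradStar (gradStar_curl hT hA))
    have h2 := (mem_graph_curl.1 hA).1
    have hsum := gradProjection_add_curlProjection hT (mem_H2.1 h2).1
    -- The potential `A` need not be divergence free. Its gradient part stays in `H2` and is curl
    -- free, so subtracting it leaves a divergence-free potential with the same curl `η`.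
    have h3 := Submodule.sub_mem _ hA (curl_of_mem_gradRange hT (gradProjection_mem_H2 h2)
      (Submodule.starProjection_apply_mem _ _))
    rw [Prod.mk_sub_mk, sub_zero, ← eq_sub_of_add_eq' hsum] at h3
    exact LinearPMap.mem_domain_of_mem_graph (hgraph.2 ⟨_, c, hc,
      gradStar_of_mem_curlRange hT (H2_le_H1 (curlProjection_mem_H2 hT h2))
        (Submodule.starProjection_apply_mem _ _), h3, hc⟩)

theorem H2_eq_sup (hT : StronglyContinuous P) :
    H2 P = (H2 P ⊓ gradRange P) ⊔ (H2 P ⊓ curlRange P) := by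
  refine le_antisymm (fun ξ hξ => ?_) (sup_le inf_le_left inf_le_left)
  rw [← gradProjection_add_curlProjection hT (mem_H2.1 hξ).1]
  exact Submodule.add_mem_sup
    ⟨gradProjection_mem_H2 hξ, Submodule.starProjection_apply_mem _ _⟩
    ⟨curlProjection_mem_H2 hT hξ, Submodule.starProjection_apply_mem _ _⟩

theorem H2_inf_curlRange (hT : StronglyContinuous P) :
    H2 P ⊓ curlRange P = H2 P ⊓ (gradStar P).kernel := by
  ext ζ
  refine and_congr_right fun h2 => ⟨fun h => ?_, fun h => ?_⟩
  · exact LinearPMap.mem_kernel.2 (gradStar_of_mem_curlRange hT (H2_le_H1 h2) h)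
  · exact mem_curlRange_of_mem_orthogonal hT (mem_H2.1 h2).1
      (mem_gradRange_orthogonal_of_gradStar (LinearPMap.mem_kernel.1 h))

theorem H2_inf_gradRange (hT : StronglyContinuous P) :
    H2 P ⊓ gradRange P = (curl P).kernel := by
  ext ξ
  refine ⟨fun h => LinearPMap.mem_kernel.2 (curl_of_mem_gradRange hT h.1 h.2), fun h => ?_⟩
  have h1 := LinearPMap.mem_kernel.1 h
  have h2 := (mem_graph_curl.1 h1).1
  exact ⟨h2, mem_gradRange_of_mem_orthogonal hT (mem_H2.1 h2).1
    (mem_curlRange_orthogonal_of_curlH1 (curl_le_curlH1 h1))⟩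

end

end StationaryHelmholtz

/-! ### Algebra of restricted operators and the main theorem -/

theorem LinearPMap.toPMap_pcomp_toPMap_eq_zero {R E : Type*} [Ring R] [AddCommGroup E] [Module R E]
    {p q : E →ₗ[R] E} {K : Submodule R E} (hq : ∀ x ∈ K, q x ∈ K) (hpq : ∀ x ∈ K, p (q x) = 0) :
    (p.toPMap K).pcomp (q.toPMap K) = (0 : E →ₗ[R] E).toPMap K := by
  refine LinearPMap.eq_of_eq_graph (Submodule.ext fun ⟨x, y⟩ => ?_)
  simp only [LinearPMap.mem_graph_pcomp, LinearPMap.mem_graph_toPMap, LinearMap.zero_apply]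
  constructor
  · rintro ⟨_, ⟨hx, rfl⟩, _, rfl⟩
    exact ⟨hx, hpq x hx⟩
  · rintro ⟨hx, rfl⟩
    exact ⟨_, ⟨hx, rfl⟩, hq x hx, (hpq x hx).symm⟩

theorem LinearPMap.toPMap_add_toPMap {R E : Type*} [Ring R] [AddCommGroup E] [Module R E]
    {p q r : E →ₗ[R] E} {K : Submodule R E} (h : ∀ x ∈ K, p x + q x = r x) :
    p.toPMap K + q.toPMap K = r.toPMap K :=
  LinearPMap.ext (inf_idem K) fun x hx _ => h x hx.1

open StationaryHelmholtz in
theorem mainTheorem4 {Ω : Type*} [MeasurableSpace Ω]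
    [AddAction StationaryHelmholtz.Space Ω] [MeasurableConstVAdd StationaryHelmholtz.Space Ω]
    (P : Measure Ω) [IsProbabilityMeasure P] [ErgodicVAdd StationaryHelmholtz.Space Ω P]
    (hT : ∀ f : StationaryHelmholtz.Scalar P,
      Continuous fun x => StationaryHelmholtz.translate P x f) :
    -- the inverses occurring in the formulas for the two projections exist
    (StationaryHelmholtz.gradStarGrad P).kernel = ⊥ ∧
    (StationaryHelmholtz.curlCurl P).kernel = ⊥ ∧
    -- the operators are the orthogonal projections onto the (closed) ranges, defined on
    -- the completed space
    StationaryHelmholtz.Gam P =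
      (StationaryHelmholtz.gradRange P).starProjection.toLinearMap.toPMap
        (StationaryHelmholtz.H2bar P) ∧
    StationaryHelmholtz.Ups P =
      (StationaryHelmholtz.curlRange P).starProjection.toLinearMap.toPMap
        (StationaryHelmholtz.H2bar P) ∧
    -- they are mutually orthogonal and resolve the identity
    (StationaryHelmholtz.Gam P).pcomp (StationaryHelmholtz.Ups P) =
      (0 : StationaryHelmholtz.Vec P →ₗ[ℂ] StationaryHelmholtz.Vec P).toPMap
        (StationaryHelmholtz.H2bar P) ∧
    (StationaryHelmholtz.Ups P).pcomp (StationaryHelmholtz.Gam P) =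
      (0 : StationaryHelmholtz.Vec P →ₗ[ℂ] StationaryHelmholtz.Vec P).toPMap
        (StationaryHelmholtz.H2bar P) ∧
    StationaryHelmholtz.Gam P + StationaryHelmholtz.Ups P =
      (LinearMap.id : StationaryHelmholtz.Vec P →ₗ[ℂ] StationaryHelmholtz.Vec P).toPMap
        (StationaryHelmholtz.H2bar P) ∧
    -- the orthogonal decomposition of the completed space
    StationaryHelmholtz.gradRange P ⟂ StationaryHelmholtz.curlRange P ∧
    StationaryHelmholtz.gradRange P ⊔ StationaryHelmholtz.curlRange P =
      StationaryHelmholtz.H2bar P ∧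
    -- ranges and kernels in the completed space
    (∀ ζ, ζ ∈ StationaryHelmholtz.curlRange P ↔ StationaryHelmholtz.IsWeaklyDivFree P ζ) ∧
    (∀ ξ, ξ ∈ StationaryHelmholtz.gradRange P ↔ StationaryHelmholtz.IsWeaklyCurlFree P ξ) ∧
    -- the same before completion: invariance, decomposition, ranges and kernels
    (∀ ξ : (StationaryHelmholtz.Gam P).domain, (ξ : StationaryHelmholtz.Vec P) ∈
      StationaryHelmholtz.H2 P → StationaryHelmholtz.Gam P ξ ∈ StationaryHelmholtz.H2 P) ∧
    (∀ ξ : (StationaryHelmholtz.Ups P).domain, (ξ : StationaryHelmholtz.Vec P) ∈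
      StationaryHelmholtz.H2 P → StationaryHelmholtz.Ups P ξ ∈ StationaryHelmholtz.H2 P) ∧
    StationaryHelmholtz.H2 P =
      (StationaryHelmholtz.H2 P ⊓ StationaryHelmholtz.gradRange P) ⊔
        (StationaryHelmholtz.H2 P ⊓ StationaryHelmholtz.curlRange P) ∧
    StationaryHelmholtz.H2 P ⊓ StationaryHelmholtz.curlRange P =
      StationaryHelmholtz.H2 P ⊓ (StationaryHelmholtz.gradStar P).kernel ∧
    StationaryHelmholtz.H2 P ⊓ StationaryHelmholtz.gradRange P =
      (StationaryHelmholtz.curl P).kernel := by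
  have ho := gradRange_isOrtho_curlRange hT
  have hsup := gradRange_sup_curlRange hT
  have hgK : ∀ x, (gradRange P).starProjection x ∈ H2bar P := fun x =>
    hsup ▸ Submodule.mem_sup_left (Submodule.starProjection_apply_mem _ x)
  have hcK : ∀ x, (curlRange P).starProjection x ∈ H2bar P := fun x =>
    hsup ▸ Submodule.mem_sup_right (Submodule.starProjection_apply_mem _ x)
  refine ⟨gradStarGrad_kernel, curlCurl_kernel hT, Gam_eq hT, Ups_eq hT, ?_, ?_, ?_, ho, hsup,
    fun ζ => ⟨isWeaklyDivFree_of_mem_curlRange hT, fun h =>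
      mem_curlRange_of_mem_orthogonal hT h.1 (mem_gradRange_orthogonal_of_weakly h)⟩,
    fun ξ => ⟨isWeaklyCurlFree_of_mem_gradRange hT, fun h =>
      mem_gradRange_of_mem_orthogonal hT h.1 (mem_curlRange_orthogonal_of_weakly h)⟩,
    ?_, ?_, H2_eq_sup hT, H2_inf_curlRange hT, H2_inf_gradRange hT⟩
  · rw [Gam_eq hT, Ups_eq hT]
    exact LinearPMap.toPMap_pcomp_toPMap_eq_zero (fun x _ => hcK x) fun x _ =>
      (Submodule.starProjection_apply_eq_zero_iff _).2
        (ho.symm (Submodule.starProjection_apply_mem _ x))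
  · rw [Gam_eq hT, Ups_eq hT]
    exact LinearPMap.toPMap_pcomp_toPMap_eq_zero (fun x _ => hgK x) fun x _ =>
      (Submodule.starProjection_apply_eq_zero_iff _).2
        (ho (Submodule.starProjection_apply_mem _ x))
  · rw [Gam_eq hT, Ups_eq hT]
    exact LinearPMap.toPMap_add_toPMap fun x hx =>
      gradProjection_add_curlProjection hT (H2bar_eq hT ▸ hx)
  · rw [Gam_eq hT]
    exact fun ξ hξ => gradProjection_mem_H2 hξ
  · rw [Ups_eq hT]
    exact fun ξ hξ => curlProjection_mem_H2 hT hξ
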